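/- Let $0<q<1$ and let $k,l$ be positive coprime integers. **The algebra $U_q(\mathfrak{su}_2)$.** It is the complex unital algebra with generators $e,f,K,K^{-1}$ and relations $KK^{-1}=K^{-1}K=1$, $Ke=q\,eK$, $Kf=q^{-1}fK$, $ef-fe=(K^2-K^{-2})/(q-q^{-1})$. Its coproduct is $\Delta(K)=K\otimes K$, $\Delta(e)=e\otimes K+K^{-1}\otimes e$, $\Delta(f)=f\otimes K+K^{-1}\otimes f$, and we write $\Delta(x)=x'\otimes x''$. Put $[n]=(q^n-q^{-n})/(q-q^{-1})$. For $\lambda\in\{0,\tfrac12,1,\dots\}$ let $M_\lambda$ be the space with basis $u_{\lambda m}$, $m=-\lambda,-\lambda+1,\dots,\lambda$, with the representation $\varrho_\lambda(K)u_{\lambda m}=q^m u_{\lambda m}$, $\varrho_\lambda(e)u_{\lambda m}=\sqrt{[\lambda-m][\lambda+m+1]}\,u_{\lambda,m+1}$, $\varrho_\lambda(f)u_{\lambda m}=\sqrt{[\lambda-m+1][\lambda+m]}\,u_{\lambda,m-1}$. The basis of $M_{\frac12}$ is denoted $e_\pm=u_{\frac12,\pm\frac12}$. **The algebra $\mathbb{C}[SU_{2,q}]$.**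 It is the linear span, in the dual of $U_q(\mathfrak{su}_2)$, of all matrix elements $t^\lambda_{mn}$, where $\varrho_\lambda(x)u_{\lambda n}=\sum_m t^\lambda_{mn}(x)\,u_{\lambda m}$, with the product $(st)(x)=s(x')t(x'')$. It carries the representation $\partial(x)t^\lambda_{mn}=\sum_p t^\lambda_{pn}(x)\,t^\lambda_{mp}$ of $U_q(\mathfrak{su}_2)$. It is generated by $\alpha=t^{1/2}_{\frac12,\frac12}$, $\beta=t^{1/2}_{\frac12,-\frac12}$, $\alpha^*=t^{1/2}_{-\frac12,-\frac12}$ and $\beta^*=-q^{-1}t^{1/2}_{-\frac12,\frac12}$. On $\mathbb{C}[SU_{2,q}]\otimes M_{\frac12}$ put $\partial'(x)=\partial(x')\otimes\varrho_{\frac12}(x'')$. **Coactions.** Let $B=\mathbb{C}[u,u^{-1}]$ with $\Delta(u)=u\otimes u$, $\epsilon(u)=1$. A coaction of $B$ on a vector space $V$ is a coassociative and counital linear map $V\to V\otimes B$. Let $\theta$ be the coaction of $B$ on $\mathbb{C}[SU_{2,q}]$ which is the algebra homomorphism with $\theta(\alpha)=\alpha\otimes u^{-k}$, $\theta(\beta)=\beta\otimes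 u^{l}$, $\theta(\alpha^*)=\alpha^*\otimes u^{k}$, $\theta(\beta^*)=\beta^*\otimes u^{-l}$. Denote by $\theta$ also the algebra homomorphism $U_q(\mathfrak{su}_2)\to U_q(\mathfrak{su}_2)\otimes B$ with $\theta(e)=e\otimes u^{-k-l}$, $\theta(f)=f\otimes u^{k+l}$, $\theta(K^{\pm1})=K^{\pm1}\otimes1$. A coaction $\hat\theta$ of $B$ on $\mathbb{C}[SU_{2,q}]\otimes M_{\frac12}$ is a *lift* of $\theta$ if $\hat\theta=\theta\otimes\theta'$ (the components in $B$ being multiplied) for some coaction $\theta'$ of $B$ on $M_{\frac12}$. It is *right $U_q(\mathfrak{su}_2)$-equivariant* if $\hat\theta(\partial'(x)s)=(\partial'\otimes\iota)(\theta(x))\,\hat\theta(s)$ for all $x\in U_q(\mathfrak{su}_2)$ and $s\in\mathbb{C}[SU_{2,q}]\otimes M_{\frac12}$ (here $B$ acts on itself by multiplication). Two equivariant lifts $\delta,\delta'$ are *equivalent* if there is a linear bijection $S$ of $\mathbb{C}[SU_{2,q}]\otimes M_{\frac12}$ which commutes with all $\partial'(x)$ and satisfies $\delta' S=(S\otimes\iota)\delta$.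 For $i\in\mathbb{Z}$ let $\theta_i:M_{\frac12}\to M_{\frac12}\otimes B$ be the linear map with $\theta_i(e_+)=e_+\otimes u^i$ and $\theta_i(e_-)=e_-\otimes u^{i+k+l}$, and put $\hat\theta_i=\theta\otimes\theta_i$. **Proposition 5.** 1. For every $i\in\mathbb{Z}$, $\theta_i$ is a coaction of $B$ on $M_{\frac12}$, and $\hat\theta_i$ is a right $U_q(\mathfrak{su}_2)$-equivariant lift of $\theta$. 2. Every right $U_q(\mathfrak{su}_2)$-equivariant lift of $\theta$ to $\mathbb{C}[SU_{2,q}]\otimes M_{\frac12}$ is equal to $\hat\theta_i$ for exactly one $i\in\mathbb{Z}$. 3. If $i\neq j$, then the lifts $\hat\theta_i$ and $\hat\theta_j$ are not equivalent. 4. If $i\neq j$, then the coactions $\theta_i$ and $\theta_j$ on $M_{\frac12}$ are not equivalent either: no linear bijection $S$ of $M_{\frac12}$ satisfies $\theta_jS=(S\otimes\iota)\theta_i$. -/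

import Mathlib

noncomputable section

namespace QuantumSU2

open scoped TensorProduct

/-- The range `(0, 1)` of the deformation parameter `q`. -/
abbrev Param : Type := Set.Ioo (0 : ℝ) 1

/-! ### The quantized enveloping algebra -/

/-- Names of the generators `e, f, k, k⁻¹`. -/
inductive Gen : Type
  | e | f | k | kinv

/-- The free algebra on `e, f, k, k⁻¹`. -/
abbrev Free : Type := FreeAlgebra ℂ Gen

/-- A generator as an element of the free algebra. -/
abbrev fr (g : Gen) : Free := FreeAlgebra.ι ℂ g

/-- The defining relations `ke = q ek`, `kf = q⁻¹ fk`, `[e, f] = (k² - k⁻²) / (q - q⁻¹)`,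
`k k⁻¹ = k⁻¹ k = 1`. -/
inductive Rel (q : Param) : Free → Free → Prop
  | ke : Rel q (fr .k * fr .e) (((q : ℝ) : ℂ) • (fr .e * fr .k))
  | kf : Rel q (fr .k * fr .f) (((q : ℝ) : ℂ)⁻¹ • (fr .f * fr .k))
  | ef : Rel q (fr .e * fr .f - fr .f * fr .e)
      ((((q : ℝ) : ℂ) - ((q : ℝ) : ℂ)⁻¹)⁻¹ • (fr .k ^ 2 - fr .kinv ^ 2))
  | kk : Rel q (fr .k * fr .kinv) 1
  | kk' : Rel q (fr .kinv * fr .k) 1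

/-- The algebra `U_q(su₂)`. -/
def Uq (q : Param) : Type := RingQuot (Rel q)

namespace Uq

variable (q : Param)

instance : Ring (Uq q) := inferInstanceAs (Ring (RingQuot (Rel q)))

instance : Algebra ℂ (Uq q) := inferInstanceAs (Algebra ℂ (RingQuot (Rel q)))

/-- The quotient map from the free algebra. -/
def mk : Free →ₐ[ℂ] Uq q := RingQuot.mkAlgHom ℂ (Rel q)

/-- The generators of `U_q(su₂)`. -/
def gen (g : Gen) : Uq q := mk q (fr g)

/-- The generator `e`. -/
abbrev e : Uq q := gen q .e
/-- The generator `f`. -/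
abbrev f : Uq q := gen q .f
/-- The generator `k`. -/
abbrev k : Uq q := gen q .k
/-- The generator `k⁻¹`. -/
abbrev kinv : Uq q := gen q .kinv

variable {q}

theorem mk_rel {x y : Free} (h : Rel q x y) : mk q x = mk q y :=
  RingQuot.mkAlgHom_rel ℂ h

theorem k_mul_e : k q * e q = ((q : ℝ) : ℂ) • (e q * k q) := by
  simpa only [gen, map_mul, map_sub, map_pow, map_smul, map_one] using mk_rel (Rel.ke (q := q))

theorem k_mul_f : k q * f q = ((q : ℝ) : ℂ)⁻¹ • (f q * k q) := by
  simpa only [gen, map_mul, map_sub, map_pow, map_smul, map_one] using mk_rel (Rel.kf (q := q))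

theorem e_mul_f_sub : e q * f q - f q * e q =
    (((q : ℝ) : ℂ) - ((q : ℝ) : ℂ)⁻¹)⁻¹ • (k q ^ 2 - kinv q ^ 2) := by
  simpa only [gen, map_mul, map_sub, map_pow, map_smul, map_one] using mk_rel (Rel.ef (q := q))

theorem k_mul_kinv : k q * kinv q = 1 := by
  simpa only [gen, map_mul, map_sub, map_pow, map_smul, map_one] using mk_rel (Rel.kk (q := q))

theorem kinv_mul_k : kinv q * k q = 1 := by
  simpa only [gen, map_mul, map_sub, map_pow, map_smul, map_one] using mk_rel (Rel.kk' (q := q))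

section lift

variable {A : Type*} [Ring A] [Algebra ℂ A]

/-- Algebra homomorphisms out of `U_q(su₂)` from the images of the generators. -/
def lift (φ : Gen → A)
    (hke : φ .k * φ .e = ((q : ℝ) : ℂ) • (φ .e * φ .k))
    (hkf : φ .k * φ .f = ((q : ℝ) : ℂ)⁻¹ • (φ .f * φ .k))
    (hef : φ .e * φ .f - φ .f * φ .e =
      (((q : ℝ) : ℂ) - ((q : ℝ) : ℂ)⁻¹)⁻¹ • (φ .k ^ 2 - φ .kinv ^ 2))
    (hkk : φ .k * φ .kinv = 1) (hkk' : φ .kinv * φ .k = 1) : Uq q →ₐ[ℂ] A :=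
  RingQuot.liftAlgHom ℂ ⟨FreeAlgebra.lift ℂ φ, by
    intro x y h
    induction h <;> simpa only [map_mul, map_sub, map_pow, map_smul, map_one,
      FreeAlgebra.lift_ι_apply]⟩

@[simp]
theorem lift_gen (φ : Gen → A) (hke hkf hef hkk hkk') (g : Gen) :
    lift (q := q) φ hke hkf hef hkk hkk' (gen q g) = φ g := by
  exact (RingQuot.liftAlgHom_mkAlgHom_apply ℂ (FreeAlgebra.lift ℂ φ) _ (fr g)).trans
    (FreeAlgebra.lift_ι_apply φ g)

theorem algHom_ext {φ ψ : Uq q →ₐ[ℂ] A} (h : ∀ g, φ (gen q g) = ψ (gen q g)) : φ = ψ := by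
  apply RingQuot.ringQuot_ext'
  apply FreeAlgebra.hom_ext
  funext g
  exact h g

end lift

theorem adjoin_gen : Algebra.adjoin ℂ (Set.range (gen q)) = ⊤ := by
  have h : (RingQuot.mkAlgHom ℂ (Rel q)).range = ⊤ :=
    (AlgHom.range_eq_top _).2 (RingQuot.mkAlgHom_surjective ℂ (Rel q))
  have h2 := FreeAlgebra.adjoin_range_ι (R := ℂ) (X := Gen)
  have h3 : Algebra.adjoin ℂ (Set.range (fun g => RingQuot.mkAlgHom ℂ (Rel q) (fr g))) = ⊤ := by
    rw [← h, ← Algebra.map_top, ← h2, AlgHom.map_adjoin, ← Set.range_comp]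
    rfl
  exact h3

theorem e_mul_kinv : e q * kinv q = ((q : ℝ) : ℂ) • (kinv q * e q) := by
  have h : kinv q * (k q * e q) * kinv q = kinv q * (((q : ℝ) : ℂ) • (e q * k q)) * kinv q := by
    rw [k_mul_e]
  rw [← mul_assoc, kinv_mul_k, one_mul, mul_smul_comm, smul_mul_assoc, mul_assoc, mul_assoc,
    k_mul_kinv, mul_one] at h
  exact h

theorem f_mul_kinv : f q * kinv q = ((q : ℝ) : ℂ)⁻¹ • (kinv q * f q) := by
  have h : kinv q * (k q * f q) * kinv q = kinv q * (((q : ℝ) : ℂ)⁻¹ • (f q * k q)) * kinv q := by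
    rw [k_mul_f]
  rw [← mul_assoc, kinv_mul_k, one_mul, mul_smul_comm, smul_mul_assoc, mul_assoc, mul_assoc,
    k_mul_kinv, mul_one] at h
  exact h

theorem q_ne_zero (q : Param) : ((q : ℝ) : ℂ) ≠ 0 := by
  exact_mod_cast q.2.1.ne'

variable (q)

/-- The coproduct: `k ↦ k ⊗ k`, `e ↦ e ⊗ k + k⁻¹ ⊗ e`, `f ↦ f ⊗ k + k⁻¹ ⊗ f`. -/
def comulHom : Uq q →ₐ[ℂ] Uq q ⊗[ℂ] Uq q :=
  lift (fun g => match g with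
    | .e => e q ⊗ₜ k q + kinv q ⊗ₜ e q
    | .f => f q ⊗ₜ k q + kinv q ⊗ₜ f q
    | .k => k q ⊗ₜ k q
    | .kinv => kinv q ⊗ₜ kinv q)
    (by
      simp only [mul_add, add_mul, Algebra.TensorProduct.tmul_mul_tmul, k_mul_e, k_mul_kinv,
        kinv_mul_k, smul_add, TensorProduct.smul_tmul', TensorProduct.tmul_smul])
    (by
      simp only [mul_add, add_mul, Algebra.TensorProduct.tmul_mul_tmul, k_mul_f, k_mul_kinv,
        kinv_mul_k, smul_add, TensorProduct.smul_tmul', TensorProduct.tmul_smul])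
    (by
      have h1 : (e q * f q) ⊗ₜ[ℂ] (k q * k q) - (f q * e q) ⊗ₜ[ℂ] (k q * k q) =
          ((((q : ℝ) : ℂ) - ((q : ℝ) : ℂ)⁻¹)⁻¹ • (k q ^ 2 - kinv q ^ 2)) ⊗ₜ[ℂ] (k q * k q) := by
        rw [← TensorProduct.sub_tmul, e_mul_f_sub]
      have h2 : (kinv q * kinv q) ⊗ₜ[ℂ] (e q * f q) - (kinv q * kinv q) ⊗ₜ[ℂ] (f q * e q) =
          (kinv q * kinv q) ⊗ₜ[ℂ]
            ((((q : ℝ) : ℂ) - ((q : ℝ) : ℂ)⁻¹)⁻¹ • (k q ^ 2 - kinv q ^ 2)) := by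
        rw [← TensorProduct.tmul_sub, e_mul_f_sub]
      have h0 := q_ne_zero q
      simp only [mul_add, add_mul, Algebra.TensorProduct.tmul_mul_tmul, k_mul_f, k_mul_e,
        e_mul_kinv, f_mul_kinv, ← TensorProduct.smul_tmul', TensorProduct.tmul_smul, smul_smul,
        inv_mul_cancel₀ h0, mul_inv_cancel₀ h0, one_smul] at h1 h2 ⊢
      rw [show ∀ a b c d a' d' : Uq q ⊗[ℂ] Uq q, a + b + (c + d) - (a' + c + (b + d')) =
        (a - a') + (d - d') by intros; abel, h1, h2, ← smul_add]
      congr 1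
      simp only [pow_two, Algebra.TensorProduct.tmul_mul_tmul, TensorProduct.sub_tmul,
        TensorProduct.tmul_sub]
      abel)
    (by simp [Algebra.TensorProduct.tmul_mul_tmul, k_mul_kinv, Algebra.TensorProduct.one_def])
    (by simp [Algebra.TensorProduct.tmul_mul_tmul, kinv_mul_k, Algebra.TensorProduct.one_def])

/-- The counit: `k ↦ 1`, `e ↦ 0`, `f ↦ 0`. -/
def counitHom : Uq q →ₐ[ℂ] ℂ :=
  lift (fun g => match g with
    | .e => 0
    | .f => 0
    | .k => 1
    | .kinv => 1) (by simp) (by simp) (by simp) (by simp) (by simp)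

/-- The bialgebra structure of `U_q(su₂)`. -/
instance : Bialgebra ℂ (Uq q) :=
  Bialgebra.ofAlgHom (comulHom q) (counitHom q)
    (by
      apply algHom_ext
      rintro (_ | _ | _ | _) <;>
      simp [comulHom, TensorProduct.add_tmul, TensorProduct.tmul_add, add_assoc])
    (by
      apply algHom_ext
      rintro (_ | _ | _ | _) <;> simp [comulHom, counitHom])
    (by
      apply algHom_ext
      rintro (_ | _ | _ | _) <;> simp [comulHom, counitHom])

theorem comul_eq (x : Uq q) : Coalgebra.comul (R := ℂ) x = comulHom q x := rfl

theorem counit_eq (x : Uq q) : Coalgebra.counit (R := ℂ) x = counitHom q x := rfl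

end Uq

/-! ### The irreducible representations -/

/-- The `q`-integer `[n]_q = (q ^ n - q ^ (-n)) / (q - q⁻¹)`. -/
def qInt (q : Param) (n : ℤ) : ℝ := ((q : ℝ) ^ n - (q : ℝ) ^ (-n)) / ((q : ℝ) - (q : ℝ)⁻¹)

section Representations

variable (q : Param) (d : ℕ)

/-! The module of highest weight `λ = d / 2` has the basis `u_{λ m}`, `m = j - d / 2`, indexed by
`j ∈ {0, …, d}`; so `λ - m = d - j` and `λ + m = j`. -/

/-- The matrix of `e`: `u_{λ m} ↦ √([λ - m][λ + m + 1]) u_{λ, m + 1}`. -/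
def eMat : Matrix (Fin (d + 1)) (Fin (d + 1)) ℂ := Matrix.of fun i j =>
  if (i : ℕ) = j + 1 then ((√(qInt q ((d : ℤ) - j) * qInt q (j + 1)) : ℝ) : ℂ) else 0

/-- The matrix of `f`: `u_{λ m} ↦ √([λ - m + 1][λ + m]) u_{λ, m - 1}`. -/
def fMat : Matrix (Fin (d + 1)) (Fin (d + 1)) ℂ := Matrix.of fun i j =>
  if (i : ℕ) + 1 = j then ((√(qInt q ((d : ℤ) - j + 1) * qInt q j) : ℝ) : ℂ) else 0

/-- The matrix of `k`: `u_{λ m} ↦ q ^ m u_{λ m}`. -/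
def kMat : Matrix (Fin (d + 1)) (Fin (d + 1)) ℂ :=
  Matrix.diagonal fun j : Fin (d + 1) => (((q : ℝ) ^ ((j : ℝ) - d / 2) : ℝ) : ℂ)

/-- The matrix of `k⁻¹`. -/
def kinvMat : Matrix (Fin (d + 1)) (Fin (d + 1)) ℂ :=
  Matrix.diagonal fun j : Fin (d + 1) => (((q : ℝ) ^ (-((j : ℝ) - d / 2)) : ℝ) : ℂ)

/-- The square root of the `q`-integer `[n]_q`. -/
def sq (n : ℕ) : ℂ := ((√(qInt q n) : ℝ) : ℂ)

/-- The square root of `q`. -/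
def rt : ℂ := ((√(q : ℝ) : ℝ) : ℂ)

theorem rt_ne_zero : rt q ≠ 0 := by
  have := Real.sqrt_pos.2 q.2.1
  unfold rt
  exact_mod_cast this.ne'

theorem rt_mul_rt : rt q * rt q = ((q : ℝ) : ℂ) := by
  have := Real.mul_self_sqrt q.2.1.le
  unfold rt
  exact_mod_cast this

theorem q_sub_inv_ne : ((q : ℝ) : ℂ) - ((q : ℝ) : ℂ)⁻¹ ≠ 0 := by
  have h : (q : ℝ) - (q : ℝ)⁻¹ < 0 := by
    have := (one_lt_inv₀ q.2.1).2 q.2.2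
    linarith [q.2.2]
  exact_mod_cast h.ne

theorem qInt_nonneg (n : ℕ) : 0 ≤ qInt q n := by
  have h : (q : ℝ) - (q : ℝ)⁻¹ < 0 := by
    have := (one_lt_inv₀ q.2.1).2 q.2.2
    linarith [q.2.2]
  apply div_nonneg_of_nonpos _ h.le
  have h1 : (q : ℝ) ^ (n : ℤ) ≤ 1 := by
    simpa using pow_le_one₀ q.2.1.le q.2.2.le
  have h2 : 1 ≤ (q : ℝ) ^ (-(n : ℤ)) := by
    rw [zpow_neg]
    exact (one_le_inv₀ (zpow_pos q.2.1 _)).2 h1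
  linarith

theorem sq_mul_sq (n : ℕ) : sq q n * sq q n = (qInt q n : ℂ) := by
  have := Real.mul_self_sqrt (qInt_nonneg q n)
  unfold sq
  exact_mod_cast this

theorem sq_zero : sq q 0 = 0 := by simp [sq, qInt]

theorem qInt_eq_rt (n : ℕ) : (qInt q n : ℂ) =
    (rt q ^ (2 * n) - (rt q ^ (2 * n))⁻¹) / (rt q ^ 2 - (rt q ^ 2)⁻¹) := by
  simp only [qInt, pow_mul, pow_two, rt_mul_rt, zpow_natCast, zpow_neg]
  push_cast
  rfl

theorem rt_sub_ne : rt q ^ 2 - (rt q ^ 2)⁻¹ ≠ 0 := by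
  rw [pow_two, rt_mul_rt]; exact q_sub_inv_ne q

theorem rt_four_ne : rt q ^ 4 - 1 ≠ 0 := by
  have h := rt_sub_ne q
  have h0 := rt_ne_zero q
  contrapose! h
  field_simp
  linear_combination h

theorem eMat_apply (i j : Fin (d + 1)) (r : ℕ) (h : (j : ℕ) + r = d) : eMat q d i j =
    if (i : ℕ) = j + 1 then sq q r * sq q (j + 1) else 0 := by
  have : (d : ℤ) - j = r := by omega
  simp only [eMat, Matrix.of_apply, this, sq]
  rw [Real.sqrt_mul (qInt_nonneg q r)]
  push_cast
  rfl

theorem fMat_apply (i j : Fin (d + 1)) (r : ℕ) (h : (j : ℕ) + r = d) : fMat q d i j =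
    if (i : ℕ) + 1 = j then sq q (r + 1) * sq q j else 0 := by
  have : (d : ℤ) - j + 1 = (r + 1 : ℕ) := by push_cast; omega
  simp only [fMat, Matrix.of_apply, this, sq]
  rw [Real.sqrt_mul (qInt_nonneg q _)]
  push_cast
  rfl

theorem rpow_half (a b : ℕ) : (((q : ℝ) ^ ((a : ℝ) - (b : ℝ) / 2) : ℝ) : ℂ) =
    rt q ^ (2 * a) / rt q ^ b := by
  have h0 : (0 : ℝ) < q := q.2.1
  rw [Real.rpow_sub h0, pow_mul, pow_two, rt_mul_rt]
  simp only [rt]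
  push_cast
  congr 1
  · simp
  · norm_cast
    rw [Real.sqrt_eq_rpow, ← Real.rpow_natCast, ← Real.rpow_mul h0.le]
    congr 1
    ring

theorem kMat_eq : kMat q d = Matrix.diagonal fun j : Fin (d + 1) => rt q ^ (2 * (j : ℕ)) / rt q ^ d := by
  unfold kMat
  congr 1
  funext j
  exact rpow_half q j d

theorem kinvMat_eq : kinvMat q d = Matrix.diagonal fun j : Fin (d + 1) => rt q ^ d / rt q ^ (2 * (j : ℕ)) := by
  unfold kinvMat
  congr 1
  funext j
  rw [Real.rpow_neg q.2.1.le, Complex.ofReal_inv, rpow_half, inv_div]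

/-- Column sums against `eMat`. -/
theorem sum_eMat (v : ℕ → ℂ) (i : Fin (d + 1)) (r : ℕ) (h : (i : ℕ) + r = d) :
    ∑ j, eMat q d i j * v j = sq q (r + 1) * sq q i * v (i - 1) := by
  rcases i with ⟨i, hi⟩
  rcases i with _ | i
  · simp only [Nat.zero_add] at h ⊢
    rw [Finset.sum_eq_zero]
    · simp [sq_zero]
    · intro j _
      simp [eMat]
  · rw [Finset.sum_eq_single ⟨i, by omega⟩]
    · rw [eMat_apply q d _ _ (r + 1) (by simp at h ⊢; omega)]
      simp
    · intro j _ hj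
      have : ¬ (i + 1 = (j : ℕ) + 1) := fun h' => hj (Fin.ext (by simp; omega))
      simp only [eMat, Matrix.of_apply]
      rw [if_neg this, zero_mul]
    · simp

/-- Column sums against `fMat`. -/
theorem sum_fMat (v : ℕ → ℂ) (i : Fin (d + 1)) (r : ℕ) (h : (i : ℕ) + r = d) :
    ∑ j, fMat q d i j * v j = sq q r * sq q (i + 1) * v (i + 1) := by
  rcases i with ⟨i, hi⟩
  rcases r with _ | r
  · rw [Finset.sum_eq_zero]
    · simp [sq_zero]
    · intro j _
      have : ¬ (i + 1 = (j : ℕ)) := by simp at h; omega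
      simp only [fMat, Matrix.of_apply]
      rw [if_neg this, zero_mul]
  · simp only at h
    rw [Finset.sum_eq_single ⟨i + 1, by omega⟩]
    · rw [fMat_apply q d _ _ r (by simp; omega)]
      simp
    · intro j _ hj
      have : ¬ (i + 1 = (j : ℕ)) := fun h' => hj (Fin.ext (by simp; omega))
      simp only [fMat, Matrix.of_apply]
      rw [if_neg this, zero_mul]
    · simp

theorem qInt_diff (a r : ℕ) :
    (qInt q (r + 1 : ℕ) : ℂ) * qInt q a - qInt q r * qInt q (a + 1 : ℕ) =
      (((q : ℝ) : ℂ) - ((q : ℝ) : ℂ)⁻¹)⁻¹ *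
        ((rt q ^ (2 * a) / rt q ^ (a + r)) ^ 2 - (rt q ^ (a + r) / rt q ^ (2 * a)) ^ 2) := by
  have h0 := rt_ne_zero q
  have h1 := rt_four_ne q
  simp only [qInt_eq_rt, ← rt_mul_rt, mul_add, pow_add, pow_mul' _ 2, mul_one]
  have ha : rt q ^ a ≠ 0 := pow_ne_zero _ h0
  have hr : rt q ^ r ≠ 0 := pow_ne_zero _ h0
  generalize rt q ^ a = x at *
  generalize rt q ^ r = y at *
  generalize rt q = p at *
  have h2 : p * p - (p * p)⁻¹ ≠ 0 := by
    contrapose! h1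
    field_simp at h1
    linear_combination h1
  have h3 : p ^ 2 - (p ^ 2)⁻¹ ≠ 0 := by rwa [pow_two]
  field_simp
  ring

/-- The irreducible representation of highest weight `d / 2`. -/
def rep : Uq q →ₐ[ℂ] Matrix (Fin (d + 1)) (Fin (d + 1)) ℂ :=
  Uq.lift (fun g => match g with
    | .e => eMat q d
    | .f => fMat q d
    | .k => kMat q d
    | .kinv => kinvMat q d)
    (by
      ext i j
      have h0 := rt_ne_zero q
      simp only [kMat_eq, Matrix.diagonal_mul, Matrix.mul_diagonal, Matrix.smul_apply, smul_eq_mul,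
        ← rt_mul_rt]
      by_cases h : (i : ℕ) = j + 1
      · rw [h]; field_simp; ring
      · simp [eMat, h])
    (by
      ext i j
      have h0 := rt_ne_zero q
      simp only [kMat_eq, Matrix.diagonal_mul, Matrix.mul_diagonal, Matrix.smul_apply, smul_eq_mul,
        ← rt_mul_rt]
      by_cases h : (i : ℕ) + 1 = j
      · rw [← h]; field_simp; ring
      · simp [fMat, h])
    (by
      ext i j
      obtain ⟨r, hr⟩ : ∃ r, (i : ℕ) + r = d := ⟨d - i, by omega⟩
      obtain ⟨s, hs⟩ : ∃ s, (j : ℕ) + s = d := ⟨d - j, by omega⟩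
      have h1 : (eMat q d * fMat q d) i j =
          sq q (r + 1) * sq q i * (if (i : ℕ) = j then sq q (s + 1) * sq q j else 0) := by
        rw [Matrix.mul_apply, Finset.sum_congr rfl fun x _ => by rw [fMat_apply q d x j s hs],
          sum_eMat q d (fun n => if n + 1 = j then sq q (s + 1) * sq q j else 0) i r hr]
        rcases Nat.eq_zero_or_pos (i : ℕ) with h | h
        · simp [h, sq_zero]
        · rw [Nat.sub_add_cancel h]
      have h2 : (fMat q d * eMat q d) i j =
          sq q r * sq q (i + 1) * (if (i : ℕ) = j then sq q s * sq q (j + 1) else 0) := by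
        rw [Matrix.mul_apply, Finset.sum_congr rfl fun x _ => by rw [eMat_apply q d x j s hs],
          sum_fMat q d (fun n => if n = j + 1 then sq q s * sq q (j + 1) else 0) i r hr]
        simp
      rw [Matrix.sub_apply, h1, h2]
      simp only [kMat_eq, kinvMat_eq, Matrix.diagonal_pow, Matrix.smul_apply, Matrix.sub_apply,
        smul_eq_mul]
      by_cases hij : i = j
      · subst hij
        obtain rfl : r = s := by omega
        simp only [Matrix.diagonal_apply_eq, if_true, Pi.pow_apply]
        have := qInt_diff q i r
        rw [hr] at this
        rw [← this, ← sq_mul_sq, ← sq_mul_sq, ← sq_mul_sq, ← sq_mul_sq]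
        ring
      · have : ¬ ((i : ℕ) = j) := fun h => hij (Fin.ext h)
        simp [this, hij])
    (by
      have h0 := rt_ne_zero q
      simp only [kMat_eq, kinvMat_eq, Matrix.diagonal_mul_diagonal]
      rw [← Matrix.diagonal_one]
      congr 1
      funext j
      field_simp)
    (by
      have h0 := rt_ne_zero q
      simp only [kMat_eq, kinvMat_eq, Matrix.diagonal_mul_diagonal]
      rw [← Matrix.diagonal_one]
      congr 1
      funext j
      field_simp)

@[simp] theorem rep_e : rep q d (Uq.e q) = eMat q d := by simp [rep]
@[simp] theorem rep_f : rep q d (Uq.f q) = fMat q d := by simp [rep]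
@[simp] theorem rep_k : rep q d (Uq.k q) = kMat q d := by simp [rep]
@[simp] theorem rep_kinv : rep q d (Uq.kinv q) = kinvMat q d := by simp [rep]

end Representations

/-! ### The coordinate algebra -/

section CoordinateAlgebra

variable (q : Param)

/-- The full dual of `U_q(su₂)` with the convolution product `(s t)(x) = s(x') t(x'')`, whose unit
is the counit. -/
abbrev Dual : Type := WithConv (Uq q →ₗ[ℂ] ℂ)

variable {q} in
/-- The pairing of a functional with an element of `U_q(su₂)`. -/
theorem Dual.mul_apply (s t : Dual q) (x : Uq q) :
    (s * t) x = LinearMap.mul' ℂ ℂ (TensorProduct.map s.ofConv t.ofConv (Uq.comulHom q x)) := rfl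

/-- The matrix element `t^λ_{mn}`, `x ↦ u*_{λ m}(ϱ_λ(x) u_{λ n})`, for `λ = d / 2`,
`m = i - d / 2`, `n = j - d / 2`. -/
def coeff (d : ℕ) (i j : Fin (d + 1)) : Dual q :=
  WithConv.toConv (Matrix.entryLinearMap ℂ ℂ i j ∘ₗ (rep q d).toLinearMap)

theorem coeff_apply (d : ℕ) (i j : Fin (d + 1)) (x : Uq q) : coeff q d i j x = rep q d x i j := rfl

/-- The linear span of all matrix elements. -/
def coeffSpan : Submodule ℂ (Dual q) :=
  Submodule.span ℂ {t | ∃ (d : ℕ) (i j : Fin (d + 1)), t = coeff q d i j}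

theorem coeff_mem (d : ℕ) (i j : Fin (d + 1)) : coeff q d i j ∈ coeffSpan q :=
  Submodule.subset_span ⟨d, i, j, rfl⟩

theorem coeff_zero : coeff q 0 0 0 = 1 := by
  have h : (rep q 0) = (Matrix.scalarAlgHom (Fin 1) ℂ).comp (Uq.counitHom q) := by
    apply Uq.algHom_ext
    rintro (_ | _ | _ | _) <;> ext i j <;> obtain rfl : i = 0 := Fin.fin_one_eq_zero i <;>
      obtain rfl : j = 0 := Fin.fin_one_eq_zero j <;>
      simp [Uq.counitHom, rep, eMat, fMat, kMat_eq, kinvMat_eq]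
  ext x
  change rep q 0 x 0 0 = Uq.counitHom q x
  rw [h]
  simp

/-! #### The tensor product with the two-dimensional representation -/

/-- The tensor product of the representations of highest weights `d / 2` and `1 / 2`. -/
def tensorRep (d : ℕ) :
    Uq q →ₐ[ℂ] Matrix (Fin (d + 1) × Fin 2) (Fin (d + 1) × Fin 2) ℂ :=
  ((Algebra.TensorProduct.lmul' ℂ : ℂ ⊗[ℂ] ℂ →ₐ[ℂ] ℂ).mapMatrix.comp
    (Matrix.kroneckerTMulAlgEquiv (Fin (d + 1)) (Fin 2) ℂ ℂ ℂ ℂ).toAlgHom).comp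
    ((Algebra.TensorProduct.map (rep q d) (rep q 1)).comp (Uq.comulHom q))

theorem tensorRep_apply (d : ℕ) (x : Uq q) (i j : Fin (d + 1)) (a b : Fin 2) :
    tensorRep q d x (i, a) (j, b) = (coeff q d i j * coeff q 1 a b) x := by
  rw [Dual.mul_apply]
  simp only [tensorRep, AlgHom.comp_apply]
  generalize Uq.comulHom q x = y
  induction y with
  | zero => simp
  | add y z hy hz => simp only [map_add, Matrix.add_apply, hy, hz]
  | tmul y z => simp [coeff, Matrix.map_apply]

theorem tensorRep_e (d : ℕ) (i j : Fin (d + 1)) (a b : Fin 2) :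
    tensorRep q d (Uq.e q) (i, a) (j, b) =
      eMat q d i j * kMat q 1 a b + kinvMat q d i j * eMat q 1 a b := by
  rw [tensorRep_apply, Dual.mul_apply]
  simp [Uq.comulHom, coeff]

theorem tensorRep_f (d : ℕ) (i j : Fin (d + 1)) (a b : Fin 2) :
    tensorRep q d (Uq.f q) (i, a) (j, b) =
      fMat q d i j * kMat q 1 a b + kinvMat q d i j * fMat q 1 a b := by
  rw [tensorRep_apply, Dual.mul_apply]
  simp [Uq.comulHom, coeff]

theorem tensorRep_k (d : ℕ) (i j : Fin (d + 1)) (a b : Fin 2) :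
    tensorRep q d (Uq.k q) (i, a) (j, b) = kMat q d i j * kMat q 1 a b := by
  rw [tensorRep_apply, Dual.mul_apply]
  simp [Uq.comulHom, coeff]

theorem tensorRep_kinv (d : ℕ) (i j : Fin (d + 1)) (a b : Fin 2) :
    tensorRep q d (Uq.kinv q) (i, a) (j, b) = kinvMat q d i j * kinvMat q 1 a b := by
  rw [tensorRep_apply, Dual.mul_apply]
  simp [Uq.comulHom, coeff]

theorem sum_mul_eMat (c : ℕ) (w : ℕ → ℂ) (i : Fin (c + 1)) (r : ℕ) (h : (i : ℕ) + r = c) :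
    ∑ j : Fin (c + 1), w j * eMat q c j i = w (i + 1) * (sq q r * sq q (i + 1)) := by
  simp_rw [eMat_apply q c _ i r h]
  rcases r with _ | r
  · simp [sq_zero]
  · rw [Finset.sum_eq_single ⟨i + 1, by omega⟩]
    · simp
    · intro j _ hj
      rw [if_neg fun h' => hj (Fin.ext h'), mul_zero]
    · simp

theorem sum_mul_fMat (c : ℕ) (w : ℕ → ℂ) (i : Fin (c + 1)) (r : ℕ) (h : (i : ℕ) + r = c) :
    ∑ j : Fin (c + 1), w j * fMat q c j i = w (i - 1) * (sq q (r + 1) * sq q i) := by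
  simp_rw [fMat_apply q c _ i r h]
  rcases Nat.eq_zero_or_pos (i : ℕ) with hi | hi
  · simp [hi, sq_zero]
  · rw [Finset.sum_eq_single ⟨i - 1, by omega⟩]
    · simp [Nat.sub_add_cancel hi]
    · intro j _ hj
      rw [if_neg fun h' => hj (Fin.ext (by simp; omega)), mul_zero]
    · simp

theorem qInt_one : qInt q 1 = 1 := by
  have := q_sub_inv_ne q
  simp only [qInt, zpow_one, zpow_neg]
  exact div_self (by exact_mod_cast this)

theorem sq_one : sq q 1 = 1 := by simp [sq, qInt_one]

/-- A matrix with entries `v n b i` intertwines as soon as it does so on the generators. -/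
theorem intertwine (d c : ℕ) (v : ℕ → Fin 2 → ℕ → ℂ)
    (hk : ∀ m a i, m ≤ d → i ≤ c → v m a i ≠ 0 → 2 * (m + (a : ℕ)) + c = 2 * i + d + 1)
    (he : ∀ m r i s, m + r = d → i + s = c →
      (rt q)⁻¹ * (sq q (r + 1) * sq q m * v (m - 1) 0 i) =
        v m 0 (i + 1) * (sq q s * sq q (i + 1)) ∧
      rt q * (sq q (r + 1) * sq q m * v (m - 1) 1 i) + rt q ^ d / rt q ^ (2 * m) * v m 0 i =
        v m 1 (i + 1) * (sq q s * sq q (i + 1)))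
    (hf : ∀ m r i s, m + r = d → i + s = c →
      (rt q)⁻¹ * (sq q r * sq q (m + 1) * v (m + 1) 0 i) +
          rt q ^ d / rt q ^ (2 * m) * v m 1 i =
        v m 0 (i - 1) * (sq q (s + 1) * sq q i) ∧
      rt q * (sq q r * sq q (m + 1) * v (m + 1) 1 i) =
        v m 1 (i - 1) * (sq q (s + 1) * sq q i)) (x : Uq q) :
    tensorRep q d x * Matrix.of (fun (p : Fin (d + 1) × Fin 2) (i : Fin (c + 1)) => v p.1 p.2 i) =
      Matrix.of (fun (p : Fin (d + 1) × Fin 2) (i : Fin (c + 1)) => v p.1 p.2 i) * rep q c x := by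
  have h0 := rt_ne_zero q
  have hx : x ∈ Algebra.adjoin ℂ (Set.range (Uq.gen q)) := by
    rw [Uq.adjoin_gen]; trivial
  induction hx using Algebra.adjoin_induction with
  | algebraMap r =>
    rw [AlgHom.commutes, AlgHom.commutes, Algebra.algebraMap_eq_smul_one,
      Algebra.algebraMap_eq_smul_one]
    simp
  | add x y _ _ hx hy => rw [map_add, map_add, Matrix.add_mul, Matrix.mul_add, hx, hy]
  | mul x y _ _ hx hy =>
    rw [map_mul, map_mul, Matrix.mul_assoc, hy, ← Matrix.mul_assoc, hx, Matrix.mul_assoc]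
  | mem x hx =>
    obtain ⟨g, rfl⟩ := hx
    ext ⟨m, a⟩ i
    obtain ⟨r, hr⟩ : ∃ r, (m : ℕ) + r = d := ⟨d - m, by omega⟩
    obtain ⟨s, hs⟩ : ∃ s, (i : ℕ) + s = c := ⟨c - i, by omega⟩
    rw [Matrix.mul_apply, Matrix.mul_apply, Fintype.sum_prod_type]
    simp only [Matrix.of_apply]
    have hE : ∀ a b : Fin 2, eMat q 1 a b = if a = 1 ∧ b = 0 then 1 else 0 := by
      intro a b
      fin_cases a <;> fin_cases b <;> simp [eMat, qInt_one]
    have hF : ∀ a b : Fin 2, fMat q 1 a b = if a = 0 ∧ b = 1 then 1 else 0 := by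
      intro a b
      fin_cases a <;> fin_cases b <;> simp [fMat, qInt_one]
    cases g with
    | e =>
      rw [rep_e, sum_mul_eMat q c (fun j => v m a j) i s hs]
      simp only [tensorRep_e, Fin.sum_univ_two, kMat_eq, kinvMat_eq, hE, Matrix.diagonal_apply]
      have h1 := he m r i s hr hs
      have h2 := fun b => sum_eMat q d (fun n => v n b i) m r hr
      fin_cases a
      · simp [mul_right_comm _ (rt q)⁻¹, ← Finset.sum_mul, h2]
        rw [← h1.1]; ring
      · simp [mul_right_comm _ (rt q ^ 2 / rt q), Finset.sum_add_distrib,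
          ← Finset.sum_mul, h2]
        rw [← h1.2]; field_simp; ring
    | f =>
      rw [rep_f, sum_mul_fMat q c (fun j => v m a j) i s hs]
      simp only [tensorRep_f, Fin.sum_univ_two, kMat_eq, kinvMat_eq, hF, Matrix.diagonal_apply]
      have h1 := hf m r i s hr hs
      have h2 := fun b => sum_fMat q d (fun n => v n b i) m r hr
      fin_cases a
      · simp [mul_right_comm _ (rt q)⁻¹, Finset.sum_add_distrib, ← Finset.sum_mul, h2]
        rw [← h1.1]; ring
      · simp [mul_right_comm _ (rt q ^ 2 / rt q), ← Finset.sum_mul, h2]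
        rw [← h1.2]; field_simp
    | k =>
      rw [rep_k]
      simp only [tensorRep_k, kMat_eq, Matrix.diagonal_apply]
      have h1 := hk m a i (by omega) (by omega)
      by_cases hv : v m a i = 0
      · simp [hv]
      · specialize h1 hv
        have hp : rt q ^ (2 * (m : ℕ)) * rt q ^ (2 * (a : ℕ)) * rt q ^ c =
            rt q ^ (2 * (i : ℕ)) * rt q ^ d * rt q := by
          rw [← pow_add, ← pow_add, ← pow_add, ← pow_succ]
          congr 1
          omega
        have hm := pow_ne_zero (2 * (m : ℕ)) h0
        have hi := pow_ne_zero (2 * (i : ℕ)) h0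
        have hd := pow_ne_zero d h0
        have hc := pow_ne_zero c h0
        fin_cases a
        · simp only [mul_zero, pow_zero, mul_one] at hp
          simp [ite_mul, mul_ite]
          generalize rt q ^ (2 * (m : ℕ)) = M at *
          generalize rt q ^ (2 * (i : ℕ)) = I at *
          generalize rt q ^ d = D at *
          generalize rt q ^ c = C at *
          field_simp
          linear_combination (v m 0 i) * hp
        · simp only [mul_one] at hp
          simp [ite_mul, mul_ite]
          generalize rt q ^ (2 * (m : ℕ)) = M at *
          generalize rt q ^ (2 * (i : ℕ)) = I at *
          generalize rt q ^ d = D at *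
          generalize rt q ^ c = C at *
          have hp' : M * rt q * C = I * D := mul_right_cancel₀ h0 (by linear_combination hp)
          field_simp
          linear_combination (v m 1 i) * hp'
    | kinv =>
      rw [rep_kinv]
      simp only [tensorRep_kinv, kinvMat_eq, Matrix.diagonal_apply]
      have h1 := hk m a i (by omega) (by omega)
      by_cases hv : v m a i = 0
      · simp [hv]
      · specialize h1 hv
        have hp : rt q ^ (2 * (m : ℕ)) * rt q ^ (2 * (a : ℕ)) * rt q ^ c =
            rt q ^ (2 * (i : ℕ)) * rt q ^ d * rt q := by
          rw [← pow_add, ← pow_add, ← pow_add, ← pow_succ]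
          congr 1
          omega
        have hm := pow_ne_zero (2 * (m : ℕ)) h0
        have hi := pow_ne_zero (2 * (i : ℕ)) h0
        have hd := pow_ne_zero d h0
        have hc := pow_ne_zero c h0
        fin_cases a
        · simp only [mul_zero, pow_zero, mul_one] at hp
          simp [ite_mul, mul_ite]
          generalize rt q ^ (2 * (m : ℕ)) = M at *
          generalize rt q ^ (2 * (i : ℕ)) = I at *
          generalize rt q ^ d = D at *
          generalize rt q ^ c = C at *
          field_simp
          linear_combination -(v m 0 i) * hp
        · simp only [mul_one] at hp
          simp [ite_mul, mul_ite]
          generalize rt q ^ (2 * (m : ℕ)) = M at *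
          generalize rt q ^ (2 * (i : ℕ)) = I at *
          generalize rt q ^ d = D at *
          generalize rt q ^ c = C at *
          have hp' : M * rt q * C = I * D := mul_right_cancel₀ h0 (by linear_combination hp)
          field_simp
          linear_combination -(v m 1 i) * hp'

theorem sq_succ (n : ℕ) : sq q (n + 1) * sq q (n + 1) =
    (rt q ^ n * rt q ^ n)⁻¹ + rt q ^ 2 * (sq q n * sq q n) := by
  have h0 := rt_ne_zero q
  have h1 := rt_four_ne q
  have h2 := rt_sub_ne q
  have hn := pow_ne_zero n h0
  rw [sq_mul_sq, sq_mul_sq, qInt_eq_rt, qInt_eq_rt]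
  simp only [mul_add, pow_add, two_mul, mul_one]
  generalize rt q ^ n = x at *
  generalize rt q = p at *
  have h3 : p * p - (p * p)⁻¹ ≠ 0 := by rwa [← pow_two]
  field_simp
  ring

theorem sq_succ' (n : ℕ) : sq q (n + 1) * sq q (n + 1) =
    rt q ^ n * rt q ^ n + (rt q ^ 2)⁻¹ * (sq q n * sq q n) := by
  have h0 := rt_ne_zero q
  have h1 := rt_four_ne q
  have h2 := rt_sub_ne q
  have hn := pow_ne_zero n h0
  rw [sq_mul_sq, sq_mul_sq, qInt_eq_rt, qInt_eq_rt]
  simp only [mul_add, pow_add, two_mul, mul_one]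
  generalize rt q ^ n = x at *
  generalize rt q = p at *
  have h3 : p * p - (p * p)⁻¹ ≠ 0 := by rwa [← pow_two]
  field_simp
  ring

/-- Coefficients of the embedding of the module of highest weight `(d + 1) / 2`. -/
def up (d n : ℕ) (b : Fin 2) (i : ℕ) : ℂ :=
  if n + b = i then
    if b = 0 then sq q (d + 1 - n) / rt q ^ n else rt q ^ d * sq q (n + 1) / rt q ^ n
  else 0

/-- Coefficients of the embedding of the module of highest weight `(d - 1) / 2`. -/
def down (d n : ℕ) (b : Fin 2) (i : ℕ) : ℂ :=
  if n + b = i + 1 then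
    if b = 0 then rt q ^ (d + 1) * sq q n / rt q ^ n else -(sq q (d - n) / rt q ^ (n + 1))
  else 0

/-- The embedding of the module of highest weight `(d + 1) / 2`. -/
def upMat (d : ℕ) : Matrix (Fin (d + 1) × Fin 2) (Fin (d + 1 + 1)) ℂ :=
  Matrix.of fun p i => up q d p.1 p.2 i

/-- The embedding of the module of highest weight `(c + 1 - 1) / 2`. -/
def downMat (c : ℕ) : Matrix (Fin (c + 1 + 1) × Fin 2) (Fin (c + 1)) ℂ :=
  Matrix.of fun p i => down q (c + 1) p.1 p.2 i

theorem tensorRep_mul_upMat (d : ℕ) (x : Uq q) :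
    tensorRep q d x * upMat q d = upMat q d * rep q (d + 1) x := by
  have h0 := rt_ne_zero q
  apply intertwine q d (d + 1) (up q d)
  · intro m a i _ _ hv
    have : m + (a : ℕ) = i := by
      by_contra h
      exact hv (if_neg h)
    omega
  · rintro m r i s rfl hs
    constructor
    · rcases m with _ | m
      · simp [up, sq_zero]
      · by_cases h : m = i
        · subst h
          obtain rfl : s = r + 1 + 1 := by omega
          have e1 : m + 1 + r + 1 - m = r + 1 + 1 := by omega
          have e2 : m + 1 + r + 1 - (m + 1) = r + 1 := by omega
          simp [up, e1, e2, pow_succ]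
          field_simp
        · simp [up, h]
    · by_cases h : m = i
      · subst h
        obtain rfl : s = r + 1 := by omega
        have e1 : m + r + 1 - m = r + 1 := by omega
        have e2 := sq_succ q m
        rcases m with _ | m
        · simp [up, sq_zero, sq_one]
        · simp only [up, e1, Nat.add_sub_cancel, Fin.val_one, Fin.val_zero, if_true, add_zero,
            one_ne_zero, if_false]
          rw [show ∀ A B C D : ℂ, A * B / C * (D * B) = A * (B * B) * D / C by intros; ring, e2]
          simp only [pow_add, pow_mul', pow_one]
          field_simp
          ring
      · rcases m with _ | m
        · have h1 : ¬ i = 0 := fun h' => h h'.symm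
          simp [up, h, h1, sq_zero]
        · simp [up, h]
  · rintro m r i s rfl hs
    constructor
    · by_cases h : m + 1 = i
      · subst h
        obtain rfl : s = r := by omega
        have e1 : m + s + 1 - m = s + 1 := by omega
        have e3 : m + s + 1 - (m + 1) = s := by omega
        have e2 := sq_succ' q s
        simp only [up, e1, e3, Nat.add_sub_cancel, Fin.val_one, Fin.val_zero, if_true, add_zero,
          one_ne_zero, if_false]
        rw [show ∀ A B C : ℂ, A / B * (A * C) = (A * A) * C / B by intros; ring, e2]
        simp only [pow_add, pow_mul', pow_one]
        field_simp
        ring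
      · rcases i with _ | i
        · simp [up, sq_zero]
        · have h1 : ¬ m = i := fun h' => h (by omega)
          simp [up, h1]
    · by_cases h : m + 1 + 1 = i
      · subst h
        obtain ⟨r, rfl⟩ : ∃ r', r = r' + 1 := ⟨r - 1, by omega⟩
        obtain rfl : s = r := by omega
        simp [up, pow_succ]
        field_simp
      · rcases i with _ | i
        · simp [up, sq_zero]
        · have h1 : ¬ m + 1 = i := fun h' => h (by omega)
          simp [up, h1]

theorem tensorRep_mul_downMat (c : ℕ) (x : Uq q) :
    tensorRep q (c + 1) x * downMat q c = downMat q c * rep q c x := by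
  have h0 := rt_ne_zero q
  apply intertwine q (c + 1) c (down q (c + 1))
  · intro m a i _ _ hv
    have : m + (a : ℕ) = i + 1 := by
      by_contra h
      exact hv (if_neg h)
    omega
  · rintro m r i s hm hs
    constructor
    · rcases m with _ | m
      · simp [down, sq_zero]
      · by_cases h : m = i + 1
        · subst h
          obtain rfl : s = r + 1 := by omega
          simp [down, pow_succ]
          field_simp
        · simp [down, h]
    · rcases m with _ | m
      · simp [down, sq_zero]
      · by_cases h : m = i
        · subst h
          obtain rfl : s = r := by omega
          obtain rfl : c = m + s := by omega
          have e1 : m + s + 1 - m = s + 1 := by omega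
          have e3 : m + s + 1 - (m + 1) = s := by omega
          have e2 := sq_succ' q s
          simp only [down, e1, e3, Nat.add_sub_cancel, Fin.val_one, Fin.val_zero, if_true,
            add_zero, one_ne_zero, if_false]
          rw [show ∀ A B C D : ℂ, A * (B * C * -(B / D)) = -(A * (B * B) * C / D) by
            intros; ring, e2]
          simp only [pow_add, pow_mul', pow_one]
          field_simp
          ring
        · simp [down, h]
  · rintro m r i s hm hs
    constructor
    · by_cases h : m = i
      · subst h
        obtain rfl : r = s + 1 := by omega
        obtain rfl : c = m + s := by omega
        have e1 : m + s + 1 - m = s + 1 := by omega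
        have e2 := sq_succ q m
        rcases m with _ | m
        · simp [down, sq_zero, sq_one, pow_succ]
          field_simp
          simp
        · simp only [down, e1, Nat.add_sub_cancel, Fin.val_one, Fin.val_zero, if_true,
            add_zero, one_ne_zero, if_false]
          rw [show ∀ A B C D E : ℂ, A * (B * C * (D * C / E)) = A * B * D * (C * C) / E by
            intros; ring, e2]
          simp only [pow_add, pow_mul', pow_one]
          field_simp
          ring
      · rcases i with _ | i
        · simp [down, h, sq_zero]
        · simp [down, h]
    · by_cases h : m + 1 = i
      · subst h
        obtain rfl : r = s + 2 := by omega
        obtain rfl : c = m + s + 1 := by omega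
        have e1 : m + s + 1 + 1 - m = s + 2 := by omega
        have e3 : m + s + 1 + 1 - (m + 1) = s + 1 := by omega
        simp [down, pow_succ, e1, e3]
        field_simp
      · rcases i with _ | i
        · simp [down, sq_zero]
        · have h1 : ¬ m = i := fun h' => h (by omega)
          simp [down, h1]

theorem sq_add (a b : ℕ) : sq q (a + b) * sq q (a + b) =
    sq q a * sq q a / (rt q ^ b * rt q ^ b) + rt q ^ a * rt q ^ a * (sq q b * sq q b) := by
  have h0 := rt_ne_zero q
  have h2 := rt_sub_ne q
  have ha := pow_ne_zero a h0
  have hb := pow_ne_zero b h0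
  simp only [sq_mul_sq, qInt_eq_rt, mul_add, pow_add, two_mul]
  generalize rt q ^ a = x at *
  generalize rt q ^ b = y at *
  have h3 : rt q * rt q - (rt q * rt q)⁻¹ ≠ 0 := by rwa [← pow_two]
  field_simp
  ring

theorem sq_succ_ne_zero (n : ℕ) : sq q (n + 1) ≠ 0 := by
  have h : 0 < qInt q (n + 1 : ℕ) := by
    have h : (q : ℝ) - (q : ℝ)⁻¹ < 0 := by
      have := (one_lt_inv₀ q.2.1).2 q.2.2
      linarith [q.2.2]
    apply div_pos_of_neg_of_neg _ h
    have h1 : (q : ℝ) ^ ((n + 1 : ℕ) : ℤ) < 1 := by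
      rw [zpow_natCast]
      exact pow_lt_one₀ q.2.1.le q.2.2 (by omega)
    have h2 : 1 < (q : ℝ) ^ (-((n + 1 : ℕ) : ℤ)) := by
      rw [zpow_neg]
      exact (one_lt_inv₀ (zpow_pos q.2.1 _)).2 h1
    linarith
  have := (Real.sqrt_pos.2 h).ne'
  unfold sq
  exact_mod_cast this

theorem upMat_transpose_mul (d : ℕ) :
    (upMat q d).transpose * upMat q d = (sq q (d + 1) * sq q (d + 1)) • 1 := by
  have h0 := rt_ne_zero q
  ext i j
  rw [Matrix.mul_apply, Fintype.sum_prod_type]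
  simp only [Matrix.transpose_apply, upMat, Matrix.of_apply, Fin.sum_univ_two, Matrix.smul_apply,
    smul_eq_mul]
  by_cases hij : i = j
  · subst hij
    rw [Matrix.one_apply_eq, mul_one, Finset.sum_add_distrib]
    have h1 : ∑ n : Fin (d + 1), up q d n 0 i * up q d n 0 i =
        sq q (d + 1 - i) * sq q (d + 1 - i) / (rt q ^ (i : ℕ) * rt q ^ (i : ℕ)) := by
      by_cases hi : (i : ℕ) < d + 1
      · rw [Finset.sum_eq_single ⟨i, hi⟩]
        · simp [up]
          field_simp
        · intro n _ hn
          have : ¬ (n : ℕ) = i := fun h => hn (Fin.ext h)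
          simp [up, this]
        · simp
      · have e : d + 1 - (i : ℕ) = 0 := by omega
        rw [Finset.sum_eq_zero]
        · simp [e, sq_zero]
        · intro n _
          have : ¬ (n : ℕ) = i := by omega
          simp [up, this]
    have h2 : ∑ n : Fin (d + 1), up q d n 1 i * up q d n 1 i =
        rt q ^ (d + 1) * rt q ^ (d + 1) * (sq q i * sq q i) /
          (rt q ^ (i : ℕ) * rt q ^ (i : ℕ)) := by
      rcases Nat.eq_zero_or_pos (i : ℕ) with hi | hi
      · rw [Finset.sum_eq_zero]
        · simp [hi, sq_zero]
        · intro n _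
          simp [up, hi]
      · rw [Finset.sum_eq_single ⟨i - 1, by omega⟩]
        · obtain ⟨t, ht⟩ : ∃ t, (i : ℕ) = t + 1 := ⟨i - 1, by omega⟩
          simp [up, ht, pow_succ]
          field_simp
        · intro n _ hn
          have : ¬ (n : ℕ) + 1 = i := fun h => hn (Fin.ext (by simp; omega))
          simp [up, this]
        · simp
    have h3 := sq_add q (d + 1 - i) i
    have h4 : d + 1 - (i : ℕ) + i = d + 1 := by omega
    have h5 : rt q ^ (d + 1) = rt q ^ (d + 1 - (i : ℕ)) * rt q ^ (i : ℕ) := by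
      rw [← pow_add, h4]
    rw [h4] at h3
    rw [h1, h2, h3, h5]
    field_simp
  · rw [Matrix.one_apply_ne hij, mul_zero]
    apply Finset.sum_eq_zero
    intro n _
    have h : ∀ b, up q d n b i * up q d n b j = 0 := by
      intro b
      by_cases h1 : (n : ℕ) + b = i
      · have h2 : ¬ (n : ℕ) + b = j := fun h2 => hij (Fin.ext (h1.symm.trans h2))
        simp [up, h2]
      · simp [up, h1]
    rw [h, h, add_zero]

theorem upMat_downMat (c : ℕ) :
    upMat q (c + 1) * (upMat q (c + 1)).transpose + downMat q c * (downMat q c).transpose =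
      (sq q (c + 1 + 1) * sq q (c + 1 + 1)) • 1 := by
  have h0 := rt_ne_zero q
  ext ⟨m, a⟩ ⟨n, b⟩
  simp only [Matrix.add_apply, Matrix.mul_apply, Matrix.transpose_apply, upMat, downMat,
    Matrix.of_apply, Matrix.smul_apply, smul_eq_mul]
  have hu : ∑ i : Fin (c + 1 + 1 + 1), up q (c + 1) m a i * up q (c + 1) n b i =
      up q (c + 1) m a (m + a) * up q (c + 1) n b (m + a) := by
    rw [Finset.sum_eq_single ⟨m + a, by omega⟩]
    · intro i _ hi
      have : ¬ (m : ℕ) + a = i := fun h => hi (Fin.ext h.symm)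
      simp [up, this]
    · simp
  have hd : ∑ i : Fin (c + 1), down q (c + 1) m a i * down q (c + 1) n b i =
      down q (c + 1) m a (m + a - 1) * down q (c + 1) n b (m + a - 1) := by
    by_cases hma : (m : ℕ) + a - 1 < c + 1
    · rw [Finset.sum_eq_single ⟨m + a - 1, hma⟩]
      · intro i _ hi
        have : ¬ (m : ℕ) + a = i + 1 := fun h => hi (Fin.ext (by simp; omega))
        simp [down, this]
      · simp
    · have h1 : (m : ℕ) = c + 1 := by omega
      have h2 : a = 1 := by ext; simp; omega
      subst h2
      rw [Finset.sum_eq_zero]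
      · simp [down, h1, sq_zero]
      · intro i _
        have : ¬ (m : ℕ) = i := by omega
        simp [down, this]
  rw [hu, hd]
  obtain ⟨r, hr⟩ : ∃ r, (m : ℕ) + r = c + 1 := ⟨c + 1 - m, by omega⟩
  by_cases hmn : (m : ℕ) + a = n + b
  · have key := sq_add q (r + 1) m
    have e0 : r + 1 + (m : ℕ) = c + 1 + 1 := by omega
    have e1 : c + 1 + 1 - (m : ℕ) = r + 1 := by omega
    have e2 : c + 1 - (m : ℕ) = r := by omega
    rw [e0] at key
    fin_cases a <;> fin_cases b
    · obtain rfl : m = n := by ext; simpa using hmn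
      rw [Matrix.one_apply_eq, mul_one, key]
      have e3 : rt q ^ (c + 1 + 1) = rt q ^ (r + 1) * rt q ^ (m : ℕ) := by rw [← pow_add, e0]
      rcases Nat.eq_zero_or_pos (m : ℕ) with h | h
      · simp [up, down, h, sq_zero] at e1 ⊢
        rw [← e1]
      · simp [up, down, Nat.sub_add_cancel h, e1, e3]
        field_simp
    · obtain ⟨t, ht⟩ : ∃ t, (m : ℕ) = t + 1 := ⟨n, by simpa using hmn⟩
      obtain hn : (n : ℕ) = t := by simp at hmn; omega
      have hne : ¬ ((m, (0 : Fin 2)) = (n, (1 : Fin 2))) := by simp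
      have e5 : c + 1 - t = r + 1 := by omega
      simp [up, down, ht, hn, pow_succ, e5]
      field_simp
      ring
    · obtain ⟨t, ht⟩ : ∃ t, (n : ℕ) = t + 1 := ⟨m, by simpa using hmn.symm⟩
      obtain hn : (m : ℕ) = t := by simp at hmn; omega
      have e5 : c + 1 - t = r := by omega
      simp [up, down, ht, hn, pow_succ, e5]
      field_simp
      ring
    · obtain rfl : m = n := by ext; simpa using hmn
      rw [Matrix.one_apply_eq, mul_one]
      have key' := sq_add q r (m + 1)
      have e6 : r + ((m : ℕ) + 1) = c + 1 + 1 := by omega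
      have e3 : rt q ^ (c + 1) = rt q ^ r * rt q ^ (m : ℕ) := by rw [← pow_add]; congr 1; omega
      rw [e6] at key'
      rw [key']
      simp [up, down, e2, e3, pow_succ]
      field_simp
      ring
  · have hne : ¬ (((m, a) : Fin (c + 1 + 1) × Fin 2) = (n, b)) := by
      rintro h
      cases h
      exact hmn rfl
    rw [Matrix.one_apply_ne hne, mul_zero]
    have h1 : up q (c + 1) n b (m + a) = 0 := if_neg fun h => hmn h.symm
    rw [h1, mul_zero, zero_add]
    rcases Nat.eq_zero_or_pos ((m : ℕ) + a) with h | h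
    · have hm : (m : ℕ) = 0 := by omega
      have ha : a = 0 := by ext; simp; omega
      simp [down, hm, ha]
    · have h2 : down q (c + 1) n b (m + a - 1) = 0 := if_neg fun h => hmn (by omega)
      rw [h2, mul_zero]

theorem coeff_mul_coeff_one (d : ℕ) (i j : Fin (d + 1)) (a b : Fin 2) :
    coeff q d i j * coeff q 1 a b ∈ coeffSpan q := by
  rcases d with _ | c
  · obtain rfl : i = 0 := Fin.fin_one_eq_zero i
    obtain rfl : j = 0 := Fin.fin_one_eq_zero j
    rw [coeff_zero, one_mul]
    exact coeff_mem q 1 a b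
  · have hN := mul_ne_zero (sq_succ_ne_zero q (c + 1)) (sq_succ_ne_zero q (c + 1))
    have h : coeff q (c + 1) i j * coeff q 1 a b = (sq q (c + 1 + 1) * sq q (c + 1 + 1))⁻¹ •
        (∑ k, ∑ l, (upMat q (c + 1) (i, a) k * upMat q (c + 1) (j, b) l) • coeff q (c + 2) k l +
          ∑ k, ∑ l, (downMat q c (i, a) k * downMat q c (j, b) l) • coeff q c k l) := by
      have h1 (x : Uq q) : (sq q (c + 1 + 1) * sq q (c + 1 + 1)) • tensorRep q (c + 1) x =
          upMat q (c + 1) * rep q (c + 2) x * (upMat q (c + 1)).transpose +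
            downMat q c * rep q c x * (downMat q c).transpose := by
        rw [← tensorRep_mul_upMat, ← tensorRep_mul_downMat, Matrix.mul_assoc, Matrix.mul_assoc,
          ← Matrix.mul_add, upMat_downMat, Matrix.mul_smul, Matrix.mul_one]
      rw [eq_inv_smul_iff₀ hN]
      ext x
      have h2 := congrFun (congrFun (h1 x) (i, a)) (j, b)
      rw [Matrix.smul_apply, tensorRep_apply] at h2
      refine h2.trans ?_
      simp [Matrix.mul_apply, Finset.sum_mul, coeff]
      congr 1 <;> rw [Finset.sum_comm] <;>
        exact Finset.sum_congr rfl fun _ _ => Finset.sum_congr rfl fun _ _ => by ring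
    rw [h]
    refine Submodule.smul_mem _ _ (Submodule.add_mem _ ?_ ?_) <;>
      exact Submodule.sum_mem _ fun _ _ => Submodule.sum_mem _ fun _ _ =>
        Submodule.smul_mem _ _ (coeff_mem q _ _ _)

theorem coeff_succ (d : ℕ) (i j : Fin (d + 1 + 1)) :
    coeff q (d + 1) i j = (sq q (d + 1) * sq q (d + 1))⁻¹ •
      ∑ k, ∑ l, (upMat q d k i * upMat q d l j) •
        (coeff q d k.1 l.1 * coeff q 1 k.2 l.2) := by
  have hN := mul_ne_zero (sq_succ_ne_zero q d) (sq_succ_ne_zero q d)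
  have h1 (x : Uq q) : (sq q (d + 1) * sq q (d + 1)) • rep q (d + 1) x =
      (upMat q d).transpose * tensorRep q d x * upMat q d := by
    rw [Matrix.mul_assoc, tensorRep_mul_upMat, ← Matrix.mul_assoc, upMat_transpose_mul,
      Matrix.smul_mul, Matrix.one_mul]
  rw [eq_inv_smul_iff₀ hN]
  ext x
  have h2 := congrFun (congrFun (h1 x) i) j
  rw [Matrix.smul_apply] at h2
  refine Eq.trans h2 ?_
  have h3 : ∀ s : Finset (Fin (d + 1) × Fin 2), ∀ F : Fin (d + 1) × Fin 2 → Dual q,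
      (∑ k ∈ s, F k) x = ∑ k ∈ s, F k x := by
    intro s F
    simp
  rw [h3]
  simp_rw [h3]
  simp only [Matrix.mul_apply, Finset.sum_mul, Matrix.transpose_apply]
  rw [Finset.sum_comm]
  refine Finset.sum_congr rfl fun k _ => Finset.sum_congr rfl fun l _ => ?_
  have h4 := tensorRep_apply q d x k.1 l.1 k.2 l.2
  change _ = (upMat q d k i * upMat q d l j) * (coeff q d k.1 l.1 * coeff q 1 k.2 l.2) x
  rw [← h4]
  ring

theorem coeffSpan_mul_mem {s t : Dual q} (hs : s ∈ coeffSpan q) (ht : t ∈ coeffSpan q) :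
    s * t ∈ coeffSpan q := by
  have h1 : ∀ s ∈ coeffSpan q, ∀ a b, s * coeff q 1 a b ∈ coeffSpan q := by
    intro s hs a b
    induction hs using Submodule.span_induction with
    | mem s h =>
      obtain ⟨d, i, j, rfl⟩ := h
      exact coeff_mul_coeff_one q d i j a b
    | zero => rw [zero_mul]; exact Submodule.zero_mem _
    | add s t _ _ hs ht => rw [add_mul]; exact Submodule.add_mem _ hs ht
    | smul c s _ hs => rw [smul_mul_assoc]; exact Submodule.smul_mem _ _ hs
  have h2 : ∀ (d : ℕ) (i j : Fin (d + 1)), ∀ s ∈ coeffSpan q, s * coeff q d i j ∈ coeffSpan q := by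
    intro d
    induction d with
    | zero =>
      intro i j s hs
      obtain rfl : i = 0 := Fin.fin_one_eq_zero i
      obtain rfl : j = 0 := Fin.fin_one_eq_zero j
      rwa [coeff_zero, mul_one]
    | succ d ih =>
      intro i j s hs
      rw [coeff_succ, mul_smul_comm, Finset.mul_sum]
      refine Submodule.smul_mem _ _ (Submodule.sum_mem _ fun k _ => ?_)
      rw [Finset.mul_sum]
      refine Submodule.sum_mem _ fun l _ => ?_
      rw [mul_smul_comm, ← mul_assoc]
      exact Submodule.smul_mem _ _ (h1 _ (ih _ _ s hs) _ _)
  induction ht using Submodule.span_induction with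
  | mem t h =>
    obtain ⟨d, i, j, rfl⟩ := h
    exact h2 d i j s hs
  | zero => rw [mul_zero]; exact Submodule.zero_mem _
  | add s t _ _ hs ht => rw [mul_add]; exact Submodule.add_mem _ hs ht
  | smul c s _ hs => rw [mul_smul_comm]; exact Submodule.smul_mem _ _ hs

/-- The span of all matrix elements as a subalgebra of the dual. -/
def coordSubalgebra : Subalgebra ℂ (Dual q) :=
  (coeffSpan q).toSubalgebra (coeff_zero q ▸ coeff_mem q 0 0 0) fun _ _ => coeffSpan_mul_mem q

/-- The coordinate algebra `ℂ[SU_{2,q}]`: the linear span of all matrix elements `t^λ_{mn}`, with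
the product dual to the coproduct of `U_q(su₂)`. -/
def CoordAlg : Type := coordSubalgebra q

instance : Ring (CoordAlg q) := inferInstanceAs (Ring (coordSubalgebra q))

instance : Algebra ℂ (CoordAlg q) := inferInstanceAs (Algebra ℂ (coordSubalgebra q))

/-- The inclusion of `ℂ[SU_{2,q}]` in the dual of `U_q(su₂)`. -/
def toDual : CoordAlg q →ₐ[ℂ] Dual q := (coordSubalgebra q).val

theorem toDual_injective : Function.Injective (toDual q) := Subtype.val_injective

theorem toDual_mem (s : CoordAlg q) : toDual q s ∈ coeffSpan q := Subtype.property s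

variable {q} in
@[ext]
theorem CoordAlg.ext {s r : CoordAlg q} (h : ∀ x, toDual q s x = toDual q r x) : s = r :=
  toDual_injective q (WithConv.ext (LinearMap.ext h))

/-- The matrix element `t^λ_{mn}` as an element of `ℂ[SU_{2,q}]`. -/
def t (d : ℕ) (i j : Fin (d + 1)) : CoordAlg q := ⟨coeff q d i j, coeff_mem q d i j⟩

@[simp]
theorem toDual_t (d : ℕ) (i j : Fin (d + 1)) : toDual q (t q d i j) = coeff q d i j := rfl

/-- The generator `α = t^{1/2}_{1/2, 1/2}`. -/
def alpha : CoordAlg q := t q 1 1 1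
/-- The generator `β = t^{1/2}_{1/2, -1/2}`. -/
def beta : CoordAlg q := t q 1 1 0
/-- The generator `α* = t^{1/2}_{-1/2, -1/2}`. -/
def alphaStar : CoordAlg q := t q 1 0 0
/-- The generator `β* = -q⁻¹ t^{1/2}_{-1/2, 1/2}`. -/
def betaStar : CoordAlg q := (-((q : ℝ) : ℂ)⁻¹) • t q 1 0 1

theorem span_t : Submodule.span ℂ {s | ∃ (d : ℕ) (i j : Fin (d + 1)), s = t q d i j} = ⊤ := by
  rw [eq_top_iff]
  rintro s -
  have hle : coeffSpan q ≤ (Submodule.span ℂ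
      {s | ∃ (d : ℕ) (i j : Fin (d + 1)), s = t q d i j}).map (toDual q).toLinearMap := by
    refine Submodule.span_le.2 ?_
    rintro _ ⟨d, i, j, rfl⟩
    exact ⟨t q d i j, Submodule.subset_span ⟨d, i, j, rfl⟩, rfl⟩
  obtain ⟨s', hs', h⟩ := hle (toDual_mem q s)
  exact toDual_injective q h ▸ hs'

theorem adjoin_generators :
    Algebra.adjoin ℂ {alpha q, beta q, alphaStar q, betaStar q} = ⊤ := by
  set S := Algebra.adjoin ℂ {alpha q, beta q, alphaStar q, betaStar q} with hS
  have h1 : ∀ a b : Fin 2, t q 1 a b ∈ S := by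
    intro a b
    fin_cases a <;> fin_cases b
    · exact Algebra.subset_adjoin (by simp [alphaStar])
    · have h : betaStar q ∈ S := Algebra.subset_adjoin (by simp)
      have h2 : t q 1 0 1 = (-((q : ℝ) : ℂ)) • betaStar q := by
        rw [betaStar, smul_smul, neg_mul_neg, mul_inv_cancel₀ (Uq.q_ne_zero q), one_smul]
      exact h2 ▸ S.smul_mem h _
    · exact Algebra.subset_adjoin (by simp [beta])
    · exact Algebra.subset_adjoin (by simp [alpha])
  have h2 : ∀ (d : ℕ) (i j : Fin (d + 1)), t q d i j ∈ S := by
    intro d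
    induction d with
    | zero =>
      intro i j
      obtain rfl : i = 0 := Fin.fin_one_eq_zero i
      obtain rfl : j = 0 := Fin.fin_one_eq_zero j
      have : t q 0 0 0 = 1 := toDual_injective q ((coeff_zero q).trans (map_one _).symm)
      exact this ▸ S.one_mem
    | succ d ih =>
      intro i j
      have : t q (d + 1) i j = (sq q (d + 1) * sq q (d + 1))⁻¹ •
          ∑ k, ∑ l, (upMat q d k i * upMat q d l j) • (t q d k.1 l.1 * t q 1 k.2 l.2) := by
        apply toDual_injective q
        have := coeff_succ q d i j
        simpa using this
      rw [this]
      exact S.smul_mem (S.sum_mem fun k _ => S.sum_mem fun l _ =>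
        S.smul_mem (S.mul_mem (ih _ _) (h1 _ _)) _) _
  rw [← Algebra.toSubmodule_eq_top, ← top_le_iff, ← span_t, Submodule.span_le]
  rintro _ ⟨d, i, j, rfl⟩
  exact h2 d i j

/-! #### The right regular representation -/

/-- The operator `s ↦ s(· x)` on functionals. -/
def rightTranslate (x : Uq q) : Dual q →ₗ[ℂ] Dual q where
  toFun s := WithConv.toConv (s.ofConv ∘ₗ LinearMap.mulRight ℂ x)
  map_add' _ _ := rfl
  map_smul' _ _ := rfl

theorem rightTranslate_apply (x y : Uq q) (s : Dual q) : rightTranslate q x s y = s (y * x) := rfl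

theorem rightTranslate_coeff (x : Uq q) (d : ℕ) (i j : Fin (d + 1)) :
    rightTranslate q x (coeff q d i j) = ∑ n, rep q d x n j • coeff q d i n := by
  ext y
  change rep q d (y * x) i j = _
  simp [coeff, Matrix.mul_apply, mul_comm]

theorem rightTranslate_mem (x : Uq q) {s : Dual q} (hs : s ∈ coeffSpan q) :
    rightTranslate q x s ∈ coeffSpan q := by
  have hle : coeffSpan q ≤ (coeffSpan q).comap (rightTranslate q x) := by
    refine Submodule.span_le.2 ?_
    rintro _ ⟨d, i, j, rfl⟩
    change rightTranslate q x (coeff q d i j) ∈ coeffSpan q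
    rw [rightTranslate_coeff]
    exact Submodule.sum_mem _ fun _ _ => Submodule.smul_mem _ _ (coeff_mem q _ _ _)
  exact hle hs

/-- The right regular representation `∂` of `U_q(su₂)` on `ℂ[SU_{2,q}]`:
`∂(x) t^λ_{mn} = u*_{λ m} ⊗ ϱ_λ(x) u_{λ n}`, that is, `(∂(x) s)(y) = s(y x)`. -/
def del : Uq q →ₐ[ℂ] Module.End ℂ (CoordAlg q) :=
  AlgHom.ofLinearMap
    { toFun := fun x =>
        { toFun := fun s => ⟨rightTranslate q x (toDual q s), rightTranslate_mem q x (toDual_mem q s)⟩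
          map_add' := fun _ _ => rfl
          map_smul' := fun _ _ => rfl }
      map_add' := fun x y => by
        ext s z
        exact (congrArg (toDual q s).ofConv (mul_add z x y)).trans (map_add _ _ _)
      map_smul' := fun c x => by
        ext s z
        exact (congrArg (toDual q s).ofConv (mul_smul_comm c z x)).trans (map_smul _ _ _) }
    (by
      ext s z
      exact congrArg (toDual q s).ofConv (mul_one z))
    (by
      intro x y
      ext s z
      exact congrArg (toDual q s).ofConv (mul_assoc z x y).symm)

theorem del_t (x : Uq q) (d : ℕ) (i j : Fin (d + 1)) :
    del q x (t q d i j) = ∑ n, rep q d x n j • t q d i n := by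
  apply toDual_injective q
  refine (rightTranslate_coeff q x d i j).trans ?_
  simp

end CoordinateAlgebra

/-! ### The coaction of `ℂ[u, u⁻¹]` -/

section Coaction

variable (q : Param)

/-- The Hopf algebra `B = ℂ[u, u⁻¹]`; the power `u ^ n` is `LaurentPolynomial.T n`, and it is
grouplike. -/
abbrev B : Type := LaurentPolynomial ℂ

/-- The power `u ^ n`. -/
abbrev u (n : ℤ) : B := LaurentPolynomial.T n

/-- Two-sided translation by grouplike elements is multiplicative. -/
def translate (g h : Uq q) (hg : Uq.comulHom q g = g ⊗ₜ g) (hh : Uq.comulHom q h = h ⊗ₜ h)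
    (hg1 : Uq.counitHom q g = 1) (hh1 : Uq.counitHom q h = 1) : Dual q →ₐ[ℂ] Dual q :=
  AlgHom.ofLinearMap
    { toFun := fun s => WithConv.toConv
        (s.ofConv ∘ₗ LinearMap.mulLeft ℂ g ∘ₗ LinearMap.mulRight ℂ h)
      map_add' := fun _ _ => rfl
      map_smul' := fun _ _ => rfl }
    (by
      ext x
      change Uq.counitHom q (g * (x * h)) = Uq.counitHom q x
      simp [hg1, hh1])
    (by
      intro s r
      ext x
      change (s * r) (g * (x * h)) = _
      rw [Dual.mul_apply, Dual.mul_apply]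
      simp only [map_mul, hg, hh]
      generalize Uq.comulHom q x = y
      induction y with
      | zero => simp
      | add y z hy hz => simp only [mul_add, add_mul, map_add, hy, hz]
      | tmul y z =>
        simp
        rfl)

theorem translate_apply (g h : Uq q) (hg hh hg1 hh1) (s : Dual q) (x : Uq q) :
    translate q g h hg hh hg1 hh1 s x = s (g * (x * h)) := rfl

/-- Evaluation of Laurent polynomials at `u = z`. -/
def evalB (z : ℂˣ) : B →ₐ[ℂ] ℂ :=
  AddMonoidAlgebra.lift ℂ ℂ ℤ ((Units.coeHom ℂ).comp (zpowersHom ℂˣ z))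

theorem evalB_T (z : ℂˣ) (n : ℤ) : evalB z (u n) = (z : ℂ) ^ n := by
  refine (AddMonoidAlgebra.lift_single (R := ℂ) _ n 1).trans ?_
  simp

/-- The unit `q`. -/
def qUnit : ℂˣ := Units.mk0 ((q : ℝ) : ℂ) (Uq.q_ne_zero q)

/-- Evaluation at `u = q ^ n`. -/
def evalAt (n : ℕ) : CoordAlg q ⊗[ℂ] B →ₐ[ℂ] Dual q :=
  Algebra.TensorProduct.lift (toDual q)
    ((Algebra.ofId ℂ (Dual q)).comp (evalB (qUnit q ^ n)))
    fun s b => (Algebra.commutes (evalB (qUnit q ^ n) b) (toDual q s)).symm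

theorem evalAt_tmul (n : ℕ) (s : CoordAlg q) (b : B) :
    evalAt q n (s ⊗ₜ b) = evalB (qUnit q ^ n) b • (toDual q s) := by
  rw [Algebra.smul_def, Algebra.commutes]
  rfl

theorem q_zpow_injective : Function.Injective fun n : ℤ => ((q : ℝ) : ℂ) ^ n := by
  intro m n h
  have h1 : (q : ℝ) ^ m = (q : ℝ) ^ n := by
    simp only at h
    exact_mod_cast h
  exact zpow_right_injective₀ q.2.1 q.2.2.ne h1

theorem evalAt_injective (P : CoordAlg q ⊗[ℂ] B) (h : ∀ n, evalAt q n P = 0) : P = 0 := by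
  let bas : Module.Basis ℤ ℂ B := ⟨AddMonoidAlgebra.coeffLinearEquiv ℂ⟩
  let E := TensorProduct.equivFinsuppOfBasisRight (M := CoordAlg q) bas
  obtain ⟨F, rfl⟩ := E.symm.surjective P
  have hE : ∀ n : ℤ, bas n = u n := fun n => rfl
  have h1 : E.symm F = F.sum fun n s => s ⊗ₜ u n := by
    rw [TensorProduct.equivFinsuppOfBasisRight_symm_apply]
    rfl
  suffices F = 0 by rw [this, map_zero]
  have hind : LinearIndependent ℂ
      (fun n : ℤ => fun i : ℕ => (((q : ℝ) : ℂ) ^ n) ^ i) := by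
    have h2 := linearIndependent_monoidHom (Multiplicative ℕ) ℂ
    exact h2.comp (fun n : ℤ => (powersHom ℂ (((q : ℝ) : ℂ) ^ n))) (by
      intro m n hmn
      apply q_zpow_injective q
      simpa using congrArg (fun φ => φ (Multiplicative.ofAdd 1)) hmn)
  ext n x
  rw [linearIndependent_iff'] at hind
  by_cases hn : n ∈ F.support
  · refine hind F.support (fun n => (toDual q (F n)) x) ?_ n hn
    funext i
    have h3 := congrArg (fun s : Dual q => s x) (h i)
    rw [h1, Finsupp.sum, map_sum] at h3
    simp only [evalAt_tmul, evalB_T] at h3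
    simp only [Finset.sum_apply, Pi.smul_apply, smul_eq_mul, Pi.zero_apply]
    have h4 : ∀ s : Finset ℤ, ∀ G : ℤ → Dual q, (∑ k ∈ s, G k) x = ∑ k ∈ s, G k x := by
      intro s G
      simp
    rw [h4] at h3
    refine Eq.trans (Finset.sum_congr rfl fun k _ => ?_) h3
    change _ = _ * (toDual q (F k)) x
    rw [mul_comm]
    congr 1
    simp [qUnit, ← zpow_natCast, ← zpow_mul, mul_comm]
  · simp [Finsupp.notMem_support_iff.1 hn]

/-- Elements `g` with `Δ(g) = g ⊗ g` and `ε(g) = 1`. -/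
def Grouplike (g : Uq q) : Prop := Uq.comulHom q g = g ⊗ₜ g ∧ Uq.counitHom q g = 1

variable {q} in
theorem Grouplike.mul {g h : Uq q} (hg : Grouplike q g) (hh : Grouplike q h) :
    Grouplike q (g * h) := by
  simp [Grouplike, hg.1, hg.2, hh.1, hh.2]

variable {q} in
theorem Grouplike.pow {g : Uq q} (hg : Grouplike q g) (n : ℕ) : Grouplike q (g ^ n) := by
  simp [Grouplike, hg.1, hg.2, Algebra.TensorProduct.tmul_pow]

theorem grouplike_k : Grouplike q (Uq.k q) := by simp [Grouplike, Uq.comulHom, Uq.counitHom]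

theorem grouplike_kinv : Grouplike q (Uq.kinv q) := by
  simp [Grouplike, Uq.comulHom, Uq.counitHom]

/-- The degree `-(m + n) k + (m - n) l` of `t^λ_{mn}`. -/
def degree (k l d : ℕ) (i j : Fin (d + 1)) : ℤ :=
  ((i : ℤ) - j) * l - ((i : ℤ) + j - d) * k

theorem exists_translation (k l n : ℕ) : ∃ σ : Dual q →ₐ[ℂ] Dual q,
    ∀ (d : ℕ) (i j : Fin (d + 1)), σ (coeff q d i j) =
      (((q : ℝ) : ℂ) ^ n) ^ degree k l d i j • coeff q d i j := by
  have h0 := rt_ne_zero q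
  have hG := (((grouplike_k q).pow l).mul ((grouplike_kinv q).pow k)).pow n
  have hH := ((grouplike_kinv q).pow (k + l)).pow n
  refine ⟨translate q _ _ hG.1 hH.1 hG.2 hH.2, fun d i j => ?_⟩
  ext x
  rw [translate_apply]
  change rep q d _ i j = _ * rep q d x i j
  simp only [map_mul, map_pow, rep_k, rep_kinv, kMat_eq, kinvMat_eq, Matrix.diagonal_pow,
    Matrix.diagonal_mul_diagonal, Matrix.diagonal_mul, Matrix.mul_diagonal, Pi.pow_apply]
  have key : ((rt q ^ (2 * (i : ℕ)) / rt q ^ d) ^ l * (rt q ^ d / rt q ^ (2 * (i : ℕ))) ^ k) *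
      (rt q ^ d / rt q ^ (2 * (j : ℕ))) ^ (k + l) =
        ((q : ℝ) : ℂ) ^ degree k l d i j := by
    have hz : ((q : ℝ) : ℂ) = rt q ^ (2 : ℤ) := by rw [← rt_mul_rt]; norm_cast; ring
    rw [hz]
    simp only [← zpow_natCast, ← zpow_sub₀ h0, ← zpow_mul, ← zpow_add₀ h0]
    congr 1
    simp only [degree]
    push_cast
    ring
  have e : (((q : ℝ) : ℂ) ^ n) ^ degree k l d i j = (((q : ℝ) : ℂ) ^ degree k l d i j) ^ n := by
    rw [← zpow_natCast, ← zpow_natCast, ← zpow_mul, ← zpow_mul, mul_comm]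
  rw [e, ← key]
  simp only [mul_pow]
  ring

theorem exists_coaction (k l : ℕ) : ∃ θ : CoordAlg q →ₐ[ℂ] CoordAlg q ⊗[ℂ] B,
    ∀ (d : ℕ) (i j : Fin (d + 1)), θ (t q d i j) = t q d i j ⊗ₜ u (degree k l d i j) := by
  choose σ hσ using exists_translation q k l
  have huniq : ∀ P Q : CoordAlg q ⊗[ℂ] B, (∀ n, evalAt q n P = evalAt q n Q) → P = Q := by
    intro P Q h
    rw [← sub_eq_zero]
    exact evalAt_injective q _ fun n => by rw [map_sub, h, sub_self]
  have ht : ∀ (d : ℕ) (i j : Fin (d + 1)) (n : ℕ),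
      evalAt q n (t q d i j ⊗ₜ u (degree k l d i j)) = σ n (toDual q (t q d i j)) := by
    intro d i j n
    rw [evalAt_tmul, evalB_T]
    refine Eq.trans ?_ (hσ n d i j).symm
    simp [qUnit]
  have hex : ∀ s : CoordAlg q, ∃ P : CoordAlg q ⊗[ℂ] B, ∀ n, evalAt q n P = σ n (toDual q s) := by
    intro s
    have hs : s ∈ Submodule.span ℂ {s | ∃ (d : ℕ) (i j : Fin (d + 1)), s = t q d i j} := by
      rw [span_t]; trivial
    induction hs using Submodule.span_induction with
    | mem s h =>
      obtain ⟨d, i, j, rfl⟩ := h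
      exact ⟨_, ht d i j⟩
    | zero => exact ⟨0, fun n => by simp⟩
    | add s r _ _ hs hr =>
      obtain ⟨P, hP⟩ := hs
      obtain ⟨Q, hQ⟩ := hr
      exact ⟨P + Q, fun n => by simp [hP, hQ]⟩
    | smul c s _ hs =>
      obtain ⟨P, hP⟩ := hs
      exact ⟨c • P, fun n => by simp [hP]⟩
  choose F hF using hex
  refine ⟨AlgHom.ofLinearMap
    { toFun := F
      map_add' := fun s r => huniq _ _ fun n => by simp [hF]
      map_smul' := fun c s => huniq _ _ fun n => by simp [hF] }
    (huniq _ _ fun n => by simp [hF]) (fun s r => huniq _ _ fun n => by simp [hF]), ?_⟩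
  intro d i j
  exact huniq _ _ fun n => (hF _ n).trans (ht d i j n).symm

theorem existsUnique_coaction (k l : ℕ) : ∃! θ : CoordAlg q →ₐ[ℂ] CoordAlg q ⊗[ℂ] B,
    θ (alpha q) = alpha q ⊗ₜ u (-k) ∧ θ (beta q) = beta q ⊗ₜ u l ∧
      θ (alphaStar q) = alphaStar q ⊗ₜ u k ∧ θ (betaStar q) = betaStar q ⊗ₜ u (-l) := by
  obtain ⟨θ, hθ⟩ := exists_coaction q k l
  refine ⟨θ, ⟨?_, ?_, ?_, ?_⟩, ?_⟩
  · rw [alpha, hθ]; simp [degree]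
  · rw [beta, hθ]; simp [degree]
  · rw [alphaStar, hθ]; simp [degree]
  · rw [betaStar, map_smul, hθ, TensorProduct.smul_tmul']; simp [degree]
  · rintro θ' ⟨h1, h2, h3, h4⟩
    refine AlgHom.ext_of_adjoin_eq_top (adjoin_generators q) ?_
    rintro _ (rfl | rfl | rfl | rfl)
    · rw [h1, alpha, hθ]; simp [degree]
    · rw [h2, beta, hθ]; simp [degree]
    · rw [h3, alphaStar, hθ]; simp [degree]
    · rw [h4, betaStar, map_smul, hθ, TensorProduct.smul_tmul']; simp [degree]

/-- The coaction `θ` of `B` on the algebra `ℂ[SU_{2,q}]`: the algebra homomorphism with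
`α ↦ α ⊗ u^{-k}`, `β ↦ β ⊗ u^l`, and hence, as `u* = u⁻¹`, with `α* ↦ α* ⊗ u^k` and
`β* ↦ β* ⊗ u^{-l}`. -/
def theta (k l : ℕ) : CoordAlg q →ₐ[ℂ] CoordAlg q ⊗[ℂ] B :=
  (existsUnique_coaction q k l).choose

/-- The coaction `θ` of `B` on the algebra `U_q(su₂)`: `e ↦ e ⊗ u^{-k-l}`, `f ↦ f ⊗ u^{k+l}`,
`k^{±1} ↦ k^{±1} ⊗ 1`. -/
def thetaU (k l : ℕ) : Uq q →ₐ[ℂ] Uq q ⊗[ℂ] B :=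
  Uq.lift (fun g => match g with
    | .e => Uq.e q ⊗ₜ u (-k - l)
    | .f => Uq.f q ⊗ₜ u (k + l)
    | .k => Uq.k q ⊗ₜ 1
    | .kinv => Uq.kinv q ⊗ₜ 1)
    (by simp only [Algebra.TensorProduct.tmul_mul_tmul, mul_one, one_mul, Uq.k_mul_e,
      TensorProduct.smul_tmul'])
    (by simp only [Algebra.TensorProduct.tmul_mul_tmul, mul_one, one_mul, Uq.k_mul_f,
      TensorProduct.smul_tmul'])
    (by
      have h1 : u (-(k : ℤ) - l) * u (k + l) = 1 := by
        rw [u, u, ← LaurentPolynomial.T_add, ← LaurentPolynomial.T_zero]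
        congr 1
        ring
      have h2 : u ((k : ℤ) + l) * u (-k - l) = 1 := by rw [mul_comm, h1]
      simp only [Algebra.TensorProduct.tmul_mul_tmul, h1, h2, pow_two, mul_one]
      rw [← TensorProduct.sub_tmul, ← TensorProduct.sub_tmul, Uq.e_mul_f_sub,
        TensorProduct.smul_tmul', pow_two, pow_two])
    (by simp [Uq.k_mul_kinv, Algebra.TensorProduct.one_def])
    (by simp [Uq.kinv_mul_k, Algebra.TensorProduct.one_def])

/-- A (right) coaction of the Hopf algebra `B` on a vector space: a linear map `V → V ⊗ B` that is
coassociative and counital. -/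
structure IsCoaction {V : Type*} [AddCommMonoid V] [Module ℂ V] (δ : V →ₗ[ℂ] V ⊗[ℂ] B) : Prop where
  coassoc : (TensorProduct.assoc ℂ V B B).toLinearMap ∘ₗ LinearMap.rTensor B δ ∘ₗ δ =
    LinearMap.lTensor V Coalgebra.comul ∘ₗ δ
  counit : (TensorProduct.rid ℂ V).toLinearMap ∘ₗ LinearMap.lTensor V Coalgebra.counit ∘ₗ δ =
    LinearMap.id

/-- The tensor product `δ ⊗ δ'` of two coactions, the factors in `B` being multiplied:
`v ⊗ w ↦ v₀ ⊗ w₀ ⊗ v₁ w₁`. -/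
def tensorCoaction {V W : Type*} [AddCommMonoid V] [Module ℂ V] [AddCommMonoid W] [Module ℂ W]
    (δ : V →ₗ[ℂ] V ⊗[ℂ] B) (δ' : W →ₗ[ℂ] W ⊗[ℂ] B) :
    V ⊗[ℂ] W →ₗ[ℂ] (V ⊗[ℂ] W) ⊗[ℂ] B :=
  LinearMap.lTensor (V ⊗[ℂ] W) (LinearMap.mul' ℂ B) ∘ₗ
    (TensorProduct.tensorTensorTensorComm ℂ V B W B).toLinearMap ∘ₗ TensorProduct.map δ δ'

/-! ### Spinors -/

/-- The spinor module `M_{1/2}`. -/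
abbrev Spin : Type := Fin 2 → ℂ

/-- The basis vector `e₊` of weight `1 / 2`. -/
def ePlus : Spin := Pi.single 1 1

/-- The basis vector `e₋` of weight `-1 / 2`. -/
def eMinus : Spin := Pi.single 0 1

/-- The action `ϱ_{1/2}` of `U_q(su₂)` on the spinor module. -/
def rho : Uq q →ₐ[ℂ] Module.End ℂ Spin :=
  (Matrix.toLinAlgEquiv' (R := ℂ) (n := Fin 2)).toAlgHom.comp (rep q 1)

/-- The space of spinors `ℂ[SU_{2,q}] ⊗ M_{1/2}`. -/
abbrev Spinors : Type := CoordAlg q ⊗[ℂ] Spin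

/-- The right representation `∂'(x) = ∂(x') ⊗ ϱ_{1/2}(x'')` of `U_q(su₂)` on spinors. -/
def del' : Uq q →ₐ[ℂ] Module.End ℂ (Spinors q) :=
  (Module.endTensorEndAlgHom (R := ℂ) (S := ℂ) (A := ℂ)).comp
    ((Algebra.TensorProduct.map (del q) (rho q)).comp (Uq.comulHom q))

/-- The action `∂' ⊗ ι` of `U_q(su₂) ⊗ B` on `ℂ[SU_{2,q}] ⊗ M_{1/2} ⊗ B`; the factor `B` acts by
multiplication. -/
def delB : Uq q ⊗[ℂ] B →ₐ[ℂ] Module.End ℂ (Spinors q ⊗[ℂ] B) :=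
  (Module.endTensorEndAlgHom (R := ℂ) (S := ℂ) (A := ℂ)).comp
    (Algebra.TensorProduct.map (del' q) (Algebra.lmul ℂ B))

/-- A lift of `θ`: a coaction on spinors of the form `θ ⊗ θ'`, where `θ'` is a coaction on the
spinor module. -/
def IsLift (k l : ℕ) (δ : Spinors q →ₗ[ℂ] Spinors q ⊗[ℂ] B) : Prop :=
  IsCoaction δ ∧ ∃ θ' : Spin →ₗ[ℂ] Spin ⊗[ℂ] B,
    IsCoaction θ' ∧ δ = tensorCoaction (theta q k l).toLinearMap θ'

/-- Right `U_q(su₂)`-equivariance: `δ(∂'(x) s) = (∂' ⊗ ι)(θ(x)) δ(s)`. -/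
def IsEquivariant (k l : ℕ) (δ : Spinors q →ₗ[ℂ] Spinors q ⊗[ℂ] B) : Prop :=
  ∀ (x : Uq q) (s : Spinors q), δ (del' q x s) = delB q (thetaU q k l x) (δ s)

/-- The linear bijection `S` is an isomorphism from the `B`-comodule `(V, δ)` to `(V, δ')`. -/
def Intertwines {V : Type*} [AddCommMonoid V] [Module ℂ V] (δ δ' : V →ₗ[ℂ] V ⊗[ℂ] B)
    (S : V ≃ₗ[ℂ] V) : Prop :=
  ∀ v, δ' (S v) = LinearMap.rTensor B S.toLinearMap (δ v)

/-- Equivalence of equivariant coactions on spinors: some linear bijection commutes with the right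
representation `∂'` of `U_q(su₂)` and intertwines the two coactions. -/
def Equivalent (δ δ' : Spinors q →ₗ[ℂ] Spinors q ⊗[ℂ] B) : Prop :=
  ∃ S : Spinors q ≃ₗ[ℂ] Spinors q, (∀ x s, S (del' q x s) = del' q x (S s)) ∧ Intertwines δ δ' S

/-- The coaction `θ_i` on the spinor module: `e₊ ↦ e₊ ⊗ u^i`, `e₋ ↦ e₋ ⊗ u^{i+k+l}`. -/
def thetaSpin (k l : ℕ) (i : ℤ) : Spin →ₗ[ℂ] Spin ⊗[ℂ] B :=
  (Pi.basisFun ℂ (Fin 2)).constr ℂ ![eMinus ⊗ₜ u (i + k + l), ePlus ⊗ₜ u i]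

/-- The coaction `θ̂_i = θ ⊗ θ_i` on spinors. -/
def thetaHat (k l : ℕ) (i : ℤ) : Spinors q →ₗ[ℂ] Spinors q ⊗[ℂ] B :=
  tensorCoaction (theta q k l).toLinearMap (thetaSpin k l i)

end Coaction

end QuantumSU2

end

/-!
Everything is graded: a coaction of `B = ℂ[u, u⁻¹]` for which `V` is spanned by homogeneous vectors,
`δ v = v ⊗ u ^ n`, is a grading by `ℤ`. The matrix elements `t^λ_{mn}` and the vectors `e_±` are
homogeneous, and a generator of `U_q(su₂)` of weight `w` lowers the degree by `w (k + l)` under `∂`,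
`ϱ_{1/2}` and hence `∂'` (`del'_gen_mem`). This is the equivariance of `θ̂_i`.

For the classification, an equivariant lift `θ ⊗ θ'` is restricted to `1 ⊗ M_{1/2}`, on which
`U_q(su₂)` acts by `ϱ_{1/2}`; so `θ'` itself is equivariant (`equivariant_factor`). Equivariance
under `k` forces `θ'(e₊) = e₊ ⊗ z`, the coaction axioms make `z` grouplike, so that `z = u ^ i`, and
equivariance under `f` then determines `θ'(e₋)`.

For the inequivalence of `θ̂_i` and `θ̂_j`, an equivalence preserves the space of invariants of
`∂'`. An invariant spinor, viewed as a function on `U_q(su₂)` with values in `M_{1/2}`, is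
determined by its value at `1` (`spinorEval_one_injective`), so this space is two-dimensional, with
an explicit homogeneous basis of degrees `i + k` and `i + l`. An isomorphism of two-dimensional
graded spaces preserves the sum of the two degrees (`Intertwines.sum_degree_eq`), whence `i = j`.
The same lemma shows that `θ_i` and `θ_j` are inequivalent.
-/

noncomputable section

namespace QuantumSU2

open scoped TensorProduct

/-! ### Homogeneous vectors of a coaction -/

section Homogeneous

variable {V W : Type*} [AddCommMonoid V] [Module ℂ V] [AddCommMonoid W] [Module ℂ W]

/-- The vectors of degree `n` of a map `δ : V → V ⊗ B`: those with `δ v = v ⊗ u ^ n`. -/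
def homogeneous (δ : V →ₗ[ℂ] V ⊗[ℂ] B) (n : ℤ) : Submodule ℂ V :=
  LinearMap.eqLocus δ ((TensorProduct.mk ℂ V B).flip (u n))

theorem mem_homogeneous {δ : V →ₗ[ℂ] V ⊗[ℂ] B} {n : ℤ} {v : V} :
    v ∈ homogeneous δ n ↔ δ v = v ⊗ₜ u n := Iff.rfl

/-- A map with a spanning set of homogeneous vectors is a coaction, since each `u ^ n` is
grouplike. -/
theorem isCoaction_of_span {δ : V →ₗ[ℂ] V ⊗[ℂ] B} {s : Set V} (hs : Submodule.span ℂ s = ⊤)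
    (h : ∀ v ∈ s, ∃ n, v ∈ homogeneous δ n) : IsCoaction δ where
  coassoc := by
    refine LinearMap.ext_on hs fun v hv => ?_
    obtain ⟨n, hn⟩ := h v hv
    rw [mem_homogeneous] at hn
    simp [hn]
  counit := by
    refine LinearMap.ext_on hs fun v hv => ?_
    obtain ⟨n, hn⟩ := h v hv
    rw [mem_homogeneous] at hn
    simp [hn]

theorem tmul_mem_homogeneous {δ : V →ₗ[ℂ] V ⊗[ℂ] B} {δ' : W →ₗ[ℂ] W ⊗[ℂ] B} {m n : ℤ} {v : V}
    {w : W} (hv : v ∈ homogeneous δ m) (hw : w ∈ homogeneous δ' n) :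
    v ⊗ₜ w ∈ homogeneous (tensorCoaction δ δ') (m + n) := by
  rw [mem_homogeneous] at *
  rw [u, LaurentPolynomial.T_add]
  simp [tensorCoaction, hv, hw, -LaurentPolynomial.T_mul]

theorem tensorCoaction_tmul_of_invariant {δ : V →ₗ[ℂ] V ⊗[ℂ] B} (δ' : W →ₗ[ℂ] W ⊗[ℂ] B) {v : V}
    (hv : δ v = v ⊗ₜ 1) (w : W) :
    tensorCoaction δ δ' (v ⊗ₜ w) = LinearMap.rTensor B (TensorProduct.mk ℂ V W v) (δ' w) := by
  simp only [tensorCoaction, LinearMap.comp_apply, TensorProduct.map_tmul, hv]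
  generalize δ' w = z
  induction z with
  | zero => simp
  | add y z hy hz => simp only [TensorProduct.tmul_add, map_add, hy, hz]
  | tmul y b => simp

theorem eq_of_smul_u_eq {c : ℂ} (hc : c ≠ 0) {m n : ℤ} (h : c • u m = c • u n) : m = n := by
  have h1 := smul_right_injective B hc h
  by_contra hmn
  have h2 := congrArg (fun p : B => p.coeff n) h1
  simp [LaurentPolynomial.T_apply, hmn] at h2

end Homogeneous

/-! ### Comparison of degrees in dimension two -/

section DegreeSum

variable {V : Type*} [AddCommGroup V] [Module ℂ V]

/-- The slice map `v ⊗ b ↦ φ(v) b`. -/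
def slice (φ : V →ₗ[ℂ] ℂ) : V ⊗[ℂ] B →ₗ[ℂ] B :=
  (TensorProduct.lid ℂ B).toLinearMap ∘ₗ LinearMap.rTensor B φ

theorem slice_tmul (φ : V →ₗ[ℂ] ℂ) (v : V) (b : B) : slice φ (v ⊗ₜ b) = φ v • b := by
  simp [slice]

theorem slice_map (φ : V →ₗ[ℂ] ℂ) (f : V →ₗ[ℂ] V) (g : B →ₗ[ℂ] B) (z : V ⊗[ℂ] B) :
    slice φ (TensorProduct.map f g z) = g (slice (φ ∘ₗ f) z) := by
  induction z using TensorProduct.induction_on with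
  | zero => simp
  | add y z hy hz => simp only [map_add, hy, hz]
  | tmul v b => simp [slice_tmul]

theorem Intertwines.mem_homogeneous {δ δ' : V →ₗ[ℂ] V ⊗[ℂ] B} {S : V ≃ₗ[ℂ] V}
    (hS : Intertwines δ δ' S) {n : ℤ} {v : V} (hv : v ∈ homogeneous δ n) :
    S v ∈ homogeneous δ' n := by
  rw [QuantumSU2.mem_homogeneous] at *
  rw [hS, hv]
  simp

/-- If `S` maps a two-dimensional space `I` to itself and intertwines `δ` and `δ'`, then the sum of
the degrees of a basis `w` of `I` that is homogeneous for both is the same for `δ` and `δ'`. The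
basis is given by coordinates `π` that are injective on `I`. -/
theorem Intertwines.sum_degree_eq {δ δ' : V →ₗ[ℂ] V ⊗[ℂ] B} {S : V ≃ₗ[ℂ] V}
    (hS : Intertwines δ δ' S) {I : Submodule ℂ V} (hI : ∀ v ∈ I, S v ∈ I)
    {w : Fin 2 → V} (hw : ∀ b, w b ∈ I) {π : V →ₗ[ℂ] Spin} (hπ : ∀ b, π (w b) = Pi.single b 1)
    (hinj : ∀ v ∈ I, π v = 0 → v = 0) {D D' : Fin 2 → ℤ} (hD : ∀ b, w b ∈ homogeneous δ (D b))
    (hD' : ∀ b, w b ∈ homogeneous δ' (D' b)) : D 0 + D 1 = D' 0 + D' 1 := by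
  have hexp (v : V) (hv : v ∈ I) : v = ∑ b, π v b • w b := by
    rw [← sub_eq_zero]
    refine hinj _ (I.sub_mem hv (I.sum_mem fun b _ => I.smul_mem _ (hw b))) ?_
    ext a
    simp [hπ, Pi.single_apply, -Fin.sum_univ_two]
  have hne (a b : Fin 2) (hab : π (S (w a)) b ≠ 0) : D a = D' b := by
    have h1 := hS.mem_homogeneous (hD a)
    rw [QuantumSU2.mem_homogeneous] at h1
    have h2 := congrArg (slice (LinearMap.proj b ∘ₗ π)) h1
    rw [slice_tmul, hexp _ (hI _ (hw a)), map_sum, map_sum, ← hexp _ (hI _ (hw a))] at h2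
    simp [QuantumSU2.mem_homogeneous.1 (hD' _), slice_tmul, hπ, -Fin.sum_univ_two,
      Pi.single_apply] at h2
    exact (eq_of_smul_u_eq hab h2).symm
  have hdet : (Matrix.of fun a b => π (S (w a)) b).det ≠ 0 := by
    intro h0
    obtain ⟨c, hc, hc0⟩ := Matrix.exists_vecMul_eq_zero_iff.2 h0
    refine hc ?_
    have h1 : π (S (∑ a, c a • w a)) = 0 := by
      ext b
      have := congrFun hc0 b
      simpa [Matrix.vecMul, dotProduct] using this
    have h2 : ∑ a, c a • w a = 0 := by
      have hsum : ∑ a, c a • w a ∈ I := I.sum_mem fun a _ => I.smul_mem _ (hw a)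
      exact S.map_eq_zero_iff.1 (hinj _ (hI _ hsum) h1)
    ext b
    have h3 := congrFun (congrArg π h2) b
    simpa [hπ, Pi.single_apply, -Fin.sum_univ_two] using h3
  rw [Matrix.det_fin_two] at hdet
  simp only [Matrix.of_apply] at hdet
  -- One of the two terms of the determinant is nonzero; it pairs the degrees of `δ` and `δ'`.
  by_cases h : π (S (w 0)) 0 * π (S (w 1)) 1 = 0
  · rw [h, zero_sub, neg_ne_zero] at hdet
    rw [hne 0 1 (left_ne_zero_of_mul hdet), hne 1 0 (right_ne_zero_of_mul hdet), add_comm]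
  · rw [hne 0 0 (left_ne_zero_of_mul h), hne 1 1 (right_ne_zero_of_mul h)]

end DegreeSum

variable (q : Param)

/-! ### Weights of the generators -/

/-- The weight of a generator: `k x k⁻¹ = q ^ wt(x) x`. -/
def Gen.wt : Gen → ℤ
  | .e => 1
  | .f => -1
  | .k => 0
  | .kinv => 0

theorem thetaU_gen (k l : ℕ) (g : Gen) :
    thetaU q k l (Uq.gen q g) = Uq.gen q g ⊗ₜ u (-(g.wt * (k + l))) := by
  rw [thetaU, Uq.lift_gen]
  cases g <;> simp [Gen.wt, sub_eq_add_neg, add_comm]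

theorem weight_of_rep_gen_ne_zero {g : Gen} {d : ℕ} {i j : Fin (d + 1)}
    (h : rep q d (Uq.gen q g) i j ≠ 0) : (i : ℤ) = j + g.wt := by
  contrapose! h
  cases g
  · have : ¬ (i : ℕ) = j + 1 := fun h' => h (by simp [Gen.wt, h'])
    simp [eMat, this]
  · have : ¬ (i : ℕ) + 1 = j := fun h' => h (by simp [Gen.wt, ← h'])
    simp [fMat, this]
  · have : i ≠ j := fun h' => h (by simp [Gen.wt, h'])
    simp [kMat, this]
  · have : i ≠ j := fun h' => h (by simp [Gen.wt, h'])
    simp [kinvMat, this]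

theorem t_zero : t q 0 0 0 = 1 := toDual_injective q ((coeff_zero q).trans (map_one _).symm)

theorem t_mem_homogeneous (k l d : ℕ) (i j : Fin (d + 1)) :
    t q d i j ∈ homogeneous (theta q k l).toLinearMap (degree k l d i j) := by
  obtain ⟨θ, hθ⟩ := exists_coaction q k l
  have h : theta q k l = θ := by
    refine (existsUnique_coaction q k l).unique (existsUnique_coaction q k l).choose_spec.1
      ⟨?_, ?_, ?_, ?_⟩
    · rw [alpha, hθ]; simp [degree]
    · rw [beta, hθ]; simp [degree]
    · rw [alphaStar, hθ]; simp [degree]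
    · rw [betaStar, map_smul, hθ, TensorProduct.smul_tmul']; simp [degree]
  rw [h]
  exact hθ d i j

theorem del_gen_t_mem (k l : ℕ) (g : Gen) (d : ℕ) (i j : Fin (d + 1)) :
    del q (Uq.gen q g) (t q d i j) ∈
      homogeneous (theta q k l).toLinearMap (degree k l d i j - g.wt * (k + l)) := by
  rw [del_t]
  refine Submodule.sum_mem _ fun n _ => ?_
  by_cases hn : rep q d (Uq.gen q g) n j = 0
  · rw [hn, zero_smul]
    exact Submodule.zero_mem _
  · have hd : degree k l d i j - g.wt * (k + l) = degree k l d i n := by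
      simp only [degree, weight_of_rep_gen_ne_zero q hn]
      ring
    rw [hd]
    exact Submodule.smul_mem _ _ (t_mem_homogeneous q k l d i n)

/-- The degree of the basis vector `e₋` (for `b = 0`) or `e₊` (for `b = 1`) under `θ_i`. -/
def spinDegree (k l : ℕ) (i : ℤ) (b : Fin 2) : ℤ := i + (1 - (b : ℤ)) * (k + l)

theorem single_mem_homogeneous (k l : ℕ) (i : ℤ) (b : Fin 2) :
    (Pi.single b 1 : Spin) ∈ homogeneous (thetaSpin k l i) (spinDegree k l i b) := by
  have h : thetaSpin k l i (Pi.basisFun ℂ (Fin 2) b) = Pi.single b 1 ⊗ₜ u (spinDegree k l i b) := by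
    rw [thetaSpin, Module.Basis.constr_basis]
    fin_cases b <;> simp [ePlus, eMinus, spinDegree, add_assoc]
  rwa [Pi.basisFun_apply] at h

theorem rho_single (x : Uq q) (b : Fin 2) :
    rho q x (Pi.single b 1) = ∑ a, rep q 1 x a b • (Pi.single a 1 : Spin) := by
  ext a
  simp [rho, Pi.single_apply]

theorem rho_gen_single_mem (k l : ℕ) (i : ℤ) (g : Gen) (b : Fin 2) :
    rho q (Uq.gen q g) (Pi.single b 1) ∈
      homogeneous (thetaSpin k l i) (spinDegree k l i b - g.wt * (k + l)) := by
  rw [rho_single]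
  refine Submodule.sum_mem _ fun a _ => ?_
  by_cases ha : rep q 1 (Uq.gen q g) a b = 0
  · rw [ha, zero_smul]
    exact Submodule.zero_mem _
  · have hd : spinDegree k l i b - g.wt * (k + l) = spinDegree k l i a := by
      simp only [spinDegree, weight_of_rep_gen_ne_zero q ha]
      ring
    rw [hd]
    exact Submodule.smul_mem _ _ (single_mem_homogeneous k l i a)

/-! ### The action on spinors -/

theorem del'_e_tmul (s : CoordAlg q) (v : Spin) : del' q (Uq.e q) (s ⊗ₜ v) =
    del q (Uq.e q) s ⊗ₜ rho q (Uq.k q) v + del q (Uq.kinv q) s ⊗ₜ rho q (Uq.e q) v := by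
  simp [del', Uq.comulHom, Module.endTensorEndAlgHom_apply]

theorem del'_f_tmul (s : CoordAlg q) (v : Spin) : del' q (Uq.f q) (s ⊗ₜ v) =
    del q (Uq.f q) s ⊗ₜ rho q (Uq.k q) v + del q (Uq.kinv q) s ⊗ₜ rho q (Uq.f q) v := by
  simp [del', Uq.comulHom, Module.endTensorEndAlgHom_apply]

theorem del'_k_tmul (s : CoordAlg q) (v : Spin) : del' q (Uq.k q) (s ⊗ₜ v) =
    del q (Uq.k q) s ⊗ₜ rho q (Uq.k q) v := by
  simp [del', Uq.comulHom, Module.endTensorEndAlgHom_apply]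

theorem del'_kinv_tmul (s : CoordAlg q) (v : Spin) : del' q (Uq.kinv q) (s ⊗ₜ v) =
    del q (Uq.kinv q) s ⊗ₜ rho q (Uq.kinv q) v := by
  simp [del', Uq.comulHom, Module.endTensorEndAlgHom_apply]

theorem delB_tmul (x : Uq q) (b c : B) (s : Spinors q) :
    delB q (x ⊗ₜ b) (s ⊗ₜ c) = del' q x s ⊗ₜ (b * c) := by
  simp [delB, Module.endTensorEndAlgHom_apply]

theorem span_spinors : Submodule.span ℂ {s : Spinors q | ∃ (d : ℕ) (i j : Fin (d + 1)) (b : Fin 2),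
    s = t q d i j ⊗ₜ Pi.single b 1} = ⊤ := by
  have h := TensorProduct.span_tmul_eq_top ℂ (CoordAlg q) Spin
  rw [eq_top_iff, ← h, Submodule.span_le]
  rintro _ ⟨s, v, rfl⟩
  have hs : s ∈ Submodule.span ℂ {s | ∃ (d : ℕ) (i j : Fin (d + 1)), s = t q d i j} := by
    rw [span_t]; trivial
  have hv : v = ∑ b, v b • (Pi.single b 1 : Spin) := by
    ext a
    simp [Pi.single_apply]
  rw [hv, TensorProduct.tmul_sum]
  refine Submodule.sum_mem _ fun b _ => ?_
  rw [TensorProduct.tmul_smul]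
  refine Submodule.smul_mem _ _ ?_
  induction hs using Submodule.span_induction with
  | mem s h =>
    obtain ⟨d, i, j, rfl⟩ := h
    exact Submodule.subset_span ⟨d, i, j, b, rfl⟩
  | zero => rw [TensorProduct.zero_tmul]; exact Submodule.zero_mem _
  | add s r _ _ hs hr => rw [TensorProduct.add_tmul]; exact Submodule.add_mem _ hs hr
  | smul c s _ hs => rw [← TensorProduct.smul_tmul']; exact Submodule.smul_mem _ _ hs

/-! ### The lifts `θ̂_i` -/

theorem t_tmul_single_mem (k l : ℕ) (m : ℤ) (d : ℕ) (i j : Fin (d + 1)) (b : Fin 2) :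
    t q d i j ⊗ₜ Pi.single b 1 ∈
      homogeneous (thetaHat q k l m) (degree k l d i j + spinDegree k l m b) :=
  tmul_mem_homogeneous (t_mem_homogeneous q k l d i j) (single_mem_homogeneous k l m b)

theorem isCoaction_thetaSpin (k l : ℕ) (i : ℤ) : IsCoaction (thetaSpin k l i) := by
  refine isCoaction_of_span (Pi.basisFun ℂ (Fin 2)).span_eq ?_
  rintro _ ⟨b, rfl⟩
  exact ⟨_, by rw [Pi.basisFun_apply]; exact single_mem_homogeneous k l i b⟩

theorem isLift_thetaHat (k l : ℕ) (i : ℤ) : IsLift q k l (thetaHat q k l i) := by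
  refine ⟨isCoaction_of_span (span_spinors q) ?_, _, isCoaction_thetaSpin k l i, rfl⟩
  rintro _ ⟨d, i', j, b, rfl⟩
  exact ⟨_, t_tmul_single_mem q k l i d i' j b⟩

theorem del'_gen_mem (k l : ℕ) (m : ℤ) (g : Gen) (d : ℕ) (i j : Fin (d + 1)) (b : Fin 2) :
    del' q (Uq.gen q g) (t q d i j ⊗ₜ Pi.single b 1) ∈ homogeneous (thetaHat q k l m)
      (-(g.wt * (k + l)) + (degree k l d i j + spinDegree k l m b)) := by
  have h (g₁ g₂ : Gen) (hg : g₁.wt + g₂.wt = g.wt) :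
      del q (Uq.gen q g₁) (t q d i j) ⊗ₜ rho q (Uq.gen q g₂) (Pi.single b 1) ∈
        homogeneous (thetaHat q k l m)
          (-(g.wt * (k + l)) + (degree k l d i j + spinDegree k l m b)) := by
    have hd : -(g.wt * (k + l)) + (degree k l d i j + spinDegree k l m b) =
        (degree k l d i j - g₁.wt * (k + l)) + (spinDegree k l m b - g₂.wt * (k + l)) := by
      rw [← hg]
      ring
    rw [hd]
    exact tmul_mem_homogeneous (del_gen_t_mem q k l g₁ d i j) (rho_gen_single_mem q k l m g₂ b)
  cases g
  · rw [del'_e_tmul]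
    exact Submodule.add_mem _ (h .e .k rfl) (h .kinv .e rfl)
  · rw [del'_f_tmul]
    exact Submodule.add_mem _ (h .f .k rfl) (h .kinv .f rfl)
  · rw [del'_k_tmul]
    exact h .k .k rfl
  · rw [del'_kinv_tmul]
    exact h .kinv .kinv rfl

theorem isEquivariant_thetaHat (k l : ℕ) (m : ℤ) : IsEquivariant q k l (thetaHat q k l m) := by
  intro x
  have hx : x ∈ Algebra.adjoin ℂ (Set.range (Uq.gen q)) := by
    rw [Uq.adjoin_gen]; trivial
  induction hx using Algebra.adjoin_induction with
  | mem x hx =>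
    obtain ⟨g, rfl⟩ := hx
    intro s
    refine LinearMap.congr_fun (f := thetaHat q k l m ∘ₗ del' q (Uq.gen q g))
      (g := delB q (thetaU q k l (Uq.gen q g)) ∘ₗ thetaHat q k l m)
      (LinearMap.ext_on (span_spinors q) ?_) s
    rintro _ ⟨d, i, j, b, rfl⟩
    rw [LinearMap.comp_apply, LinearMap.comp_apply, mem_homogeneous.1 (del'_gen_mem ..),
      mem_homogeneous.1 (t_tmul_single_mem ..), thetaU_gen, delB_tmul, u, u, u,
      ← LaurentPolynomial.T_add]
  | algebraMap r =>
    intro s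
    simp only [AlgHom.commutes, Module.algebraMap_end_apply, map_smul]
  | add x y _ _ hx hy =>
    intro s
    simp only [map_add, LinearMap.add_apply, hx, hy]
  | mul x y _ _ hx hy =>
    intro s
    simp only [map_mul, Module.End.mul_apply, hx, hy]

/-! ### Spinors as functions on the quantized enveloping algebra -/

theorem toDual_add_right (s : CoordAlg q) (x y : Uq q) :
    toDual q s (x + y) = toDual q s x + toDual q s y := map_add (toDual q s).ofConv x y

theorem toDual_one_one : toDual q 1 (1 : Uq q) = 1 :=
  (congrArg (fun s : Dual q => s 1) (map_one (toDual q))).trans (map_one (Uq.counitHom q))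

theorem toDual_t_one (d : ℕ) (i j : Fin (d + 1)) :
    toDual q (t q d i j) 1 = if i = j then 1 else 0 := by
  rw [toDual_t, coeff_apply, map_one, Matrix.one_apply]

theorem toDual_del (x y : Uq q) (s : CoordAlg q) : toDual q (del q x s) y = toDual q s (y * x) :=
  rfl

/-- The value at `y ∈ U_q(su₂)` of a spinor, viewed as a function `U_q(su₂) → M_{1/2}`. -/
def spinorEval : Uq q →ₗ[ℂ] Spinors q →ₗ[ℂ] Spin where
  toFun y := TensorProduct.lift
    { toFun := fun s => (toDual q s y) • LinearMap.id
      map_add' := fun s r => by rw [map_add, ← add_smul]; rfl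
      map_smul' := fun c s => by rw [map_smul, RingHom.id_apply, smul_smul]; rfl }
  map_add' x y := TensorProduct.ext' fun s v => by
    simp [toDual_add_right, add_smul]
  map_smul' c x := TensorProduct.ext' fun s v => by
    simp [mul_smul]

theorem spinorEval_tmul (y : Uq q) (s : CoordAlg q) (v : Spin) :
    spinorEval q y (s ⊗ₜ v) = toDual q s y • v := rfl

theorem eq_zero_of_spinorEval (s : Spinors q) (h : ∀ y, spinorEval q y s = 0) : s = 0 := by
  obtain ⟨a, rfl⟩ := (TensorProduct.piScalarRight ℂ ℂ (CoordAlg q) (Fin 2)).symm.surjective s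
  have ha : (TensorProduct.piScalarRight ℂ ℂ (CoordAlg q) (Fin 2)).symm a =
      ∑ b, a b ⊗ₜ Pi.single b 1 := by
    rw [LinearEquiv.symm_apply_eq, map_sum]
    ext1 c
    simp [Pi.single_apply]
  suffices a = 0 by rw [this, map_zero]
  funext b
  ext y
  have h1 := congrFun (h y) b
  rw [ha, map_sum] at h1
  simpa [spinorEval_tmul, Pi.single_apply] using h1

/-! ### Invariant spinors -/

/-- The spinors on which `U_q(su₂)` acts through the counit. -/
def invariants : Submodule ℂ (Spinors q) :=
  ⨅ x : Uq q, LinearMap.eqLocus (del' q x) (Uq.counitHom q x • LinearMap.id)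

theorem mem_invariants {s : Spinors q} :
    s ∈ invariants q ↔ ∀ x, del' q x s = Uq.counitHom q x • s := by
  simp [invariants, Submodule.mem_iInf, LinearMap.mem_eqLocus]

theorem mem_invariants_of_gen {s : Spinors q}
    (h : ∀ g, del' q (Uq.gen q g) s = Uq.counitHom q (Uq.gen q g) • s) : s ∈ invariants q := by
  rw [mem_invariants]
  intro x
  have hx : x ∈ Algebra.adjoin ℂ (Set.range (Uq.gen q)) := by
    rw [Uq.adjoin_gen]; trivial
  induction hx using Algebra.adjoin_induction with
  | mem x hx =>
    obtain ⟨g, rfl⟩ := hx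
    exact h g
  | algebraMap r => simp
  | add x y _ _ hx hy => rw [map_add, map_add, LinearMap.add_apply, hx, hy, add_smul]
  | mul x y _ _ hx hy =>
    rw [map_mul, map_mul, Module.End.mul_apply, hy, map_smul, hx, smul_smul, mul_comm]

theorem spinorEval_del'_k (y : Uq q) (s : Spinors q) : spinorEval q y (del' q (Uq.k q) s) =
    rho q (Uq.k q) (spinorEval q (y * Uq.k q) s) := by
  induction s using TensorProduct.induction_on with
  | zero => simp
  | add s r hs hr => simp only [map_add, hs, hr]
  | tmul s v => simp [del'_k_tmul, spinorEval_tmul, toDual_del]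

theorem spinorEval_del'_kinv (y : Uq q) (s : Spinors q) : spinorEval q y (del' q (Uq.kinv q) s) =
    rho q (Uq.kinv q) (spinorEval q (y * Uq.kinv q) s) := by
  induction s using TensorProduct.induction_on with
  | zero => simp
  | add s r hs hr => simp only [map_add, hs, hr]
  | tmul s v => simp [del'_kinv_tmul, spinorEval_tmul, toDual_del]

theorem spinorEval_del'_e (y : Uq q) (s : Spinors q) : spinorEval q y (del' q (Uq.e q) s) =
    rho q (Uq.k q) (spinorEval q (y * Uq.e q) s) +
      rho q (Uq.e q) (spinorEval q (y * Uq.kinv q) s) := by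
  induction s using TensorProduct.induction_on with
  | zero => simp
  | add s r hs hr => simp only [map_add, hs, hr]; abel
  | tmul s v => simp [del'_e_tmul, spinorEval_tmul, toDual_del]

theorem spinorEval_del'_f (y : Uq q) (s : Spinors q) : spinorEval q y (del' q (Uq.f q) s) =
    rho q (Uq.k q) (spinorEval q (y * Uq.f q) s) +
      rho q (Uq.f q) (spinorEval q (y * Uq.kinv q) s) := by
  induction s using TensorProduct.induction_on with
  | zero => simp
  | add s r hs hr => simp only [map_add, hs, hr]; abel
  | tmul s v => simp [del'_f_tmul, spinorEval_tmul, toDual_del]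

/-- An invariant spinor is determined by its value at `1`: its value at `y x` is obtained from its
value at `y` by the action of the inverse antipode of `x` on `M_{1/2}`. -/
theorem spinorEval_one_injective {s : Spinors q} (hs : s ∈ invariants q)
    (h : spinorEval q 1 s = 0) : s = 0 := by
  rw [mem_invariants] at hs
  have hk_cancel (v : Spin) : rho q (Uq.kinv q) (rho q (Uq.k q) v) = v := by
    rw [← Module.End.mul_apply, ← map_mul, Uq.kinv_mul_k, map_one, Module.End.one_apply]
  have hkinv_cancel (v : Spin) : rho q (Uq.k q) (rho q (Uq.kinv q) v) = v := by
    rw [← Module.End.mul_apply, ← map_mul, Uq.k_mul_kinv, map_one, Module.End.one_apply]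
  have hkinv (y : Uq q) : spinorEval q (y * Uq.kinv q) s = rho q (Uq.k q) (spinorEval q y s) := by
    have h1 := spinorEval_del'_kinv q y s
    rw [hs] at h1
    simp only [Uq.counitHom, Uq.lift_gen, one_smul] at h1
    rw [h1, hkinv_cancel]
  have key (x : Uq q) : ∃ T : Module.End ℂ Spin,
      ∀ y, spinorEval q (y * x) s = T (spinorEval q y s) := by
    have hx : x ∈ Algebra.adjoin ℂ (Set.range (Uq.gen q)) := by
      rw [Uq.adjoin_gen]; trivial
    induction hx using Algebra.adjoin_induction with
    | mem x hx =>
      obtain ⟨g, rfl⟩ := hx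
      cases g with
      | e =>
        refine ⟨-(rho q (Uq.kinv q) * rho q (Uq.e q) * rho q (Uq.k q)), fun y => ?_⟩
        have h1 := spinorEval_del'_e q y s
        rw [hs, hkinv] at h1
        simp only [Uq.counitHom, Uq.lift_gen, zero_smul, map_zero] at h1
        have h2 := congrArg (rho q (Uq.kinv q)) h1
        rw [map_add, hk_cancel, map_zero] at h2
        exact eq_neg_of_add_eq_zero_left h2.symm
      | f =>
        refine ⟨-(rho q (Uq.kinv q) * rho q (Uq.f q) * rho q (Uq.k q)), fun y => ?_⟩
        have h1 := spinorEval_del'_f q y s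
        rw [hs, hkinv] at h1
        simp only [Uq.counitHom, Uq.lift_gen, zero_smul, map_zero] at h1
        have h2 := congrArg (rho q (Uq.kinv q)) h1
        rw [map_add, hk_cancel, map_zero] at h2
        exact eq_neg_of_add_eq_zero_left h2.symm
      | k =>
        refine ⟨rho q (Uq.kinv q), fun y => ?_⟩
        have h1 := spinorEval_del'_k q y s
        rw [hs] at h1
        simp only [Uq.counitHom, Uq.lift_gen, one_smul] at h1
        rw [h1, hk_cancel]
      | kinv => exact ⟨_, hkinv⟩
    | algebraMap r =>
      refine ⟨algebraMap ℂ _ r, fun y => ?_⟩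
      rw [Module.algebraMap_end_apply, Algebra.algebraMap_eq_smul_one, mul_smul_comm, mul_one,
        map_smul, LinearMap.smul_apply]
    | add x x' _ _ hx hx' =>
      obtain ⟨T, hT⟩ := hx
      obtain ⟨T', hT'⟩ := hx'
      refine ⟨T + T', fun y => ?_⟩
      rw [LinearMap.add_apply, ← hT, ← hT', mul_add, map_add, LinearMap.add_apply]
    | mul x x' _ _ hx hx' =>
      obtain ⟨T, hT⟩ := hx
      obtain ⟨T', hT'⟩ := hx'
      exact ⟨T' * T, fun y => by rw [← mul_assoc, hT', hT, Module.End.mul_apply]⟩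
  refine eq_zero_of_spinorEval q s fun y => ?_
  obtain ⟨T, hT⟩ := key y
  rw [← one_mul y, hT, h, map_zero]

theorem eMat_one (a b : Fin 2) : eMat q 1 a b = if a = 1 ∧ b = 0 then 1 else 0 := by
  fin_cases a <;> fin_cases b <;> simp [eMat, qInt_one]

theorem fMat_one (a b : Fin 2) : fMat q 1 a b = if a = 0 ∧ b = 1 then 1 else 0 := by
  fin_cases a <;> fin_cases b <;> simp [fMat, qInt_one]

theorem kMat_one (a b : Fin 2) : kMat q 1 a b =
    if a = b then (if a = 0 then (rt q)⁻¹ else rt q) else 0 := by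
  have h0 := rt_ne_zero q
  fin_cases a <;> fin_cases b <;> simp [kMat_eq]
  field_simp

theorem kinvMat_one (a b : Fin 2) : kinvMat q 1 a b =
    if a = b then (if a = 0 then rt q else (rt q)⁻¹) else 0 := by
  have h0 := rt_ne_zero q
  fin_cases a <;> fin_cases b <;> simp [kinvMat_eq]
  field_simp

/-- The invariant spinor `t_{m,1/2} ⊗ e₋ - q⁻¹ t_{m,-1/2} ⊗ e₊` for `m = a - 1/2`, where
`t = t^{1/2}`. -/
def invSpinor (a : Fin 2) : Spinors q :=
  t q 1 a 1 ⊗ₜ Pi.single 0 1 - ((rt q)⁻¹ * (rt q)⁻¹) • t q 1 a 0 ⊗ₜ Pi.single 1 1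

theorem invSpinor_mem (a : Fin 2) : invSpinor q a ∈ invariants q := by
  have h0 := rt_ne_zero q
  refine mem_invariants_of_gen q fun g => ?_
  cases g
  · simp [invSpinor, del'_e_tmul, del_t, rho_single, eMat_one, kMat_one, kinvMat_one,
      Uq.counitHom, ← TensorProduct.smul_tmul', TensorProduct.tmul_smul, smul_smul, h0]
  · simp [invSpinor, del'_f_tmul, del_t, rho_single, fMat_one, kMat_one, kinvMat_one,
      Uq.counitHom, ← TensorProduct.smul_tmul', TensorProduct.tmul_smul, smul_smul, h0]
  · simp [invSpinor, del'_k_tmul, del_t, rho_single, kMat_one,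
      Uq.counitHom, ← TensorProduct.smul_tmul', TensorProduct.tmul_smul, smul_smul, h0]
  · simp [invSpinor, del'_kinv_tmul, del_t, rho_single, kinvMat_one,
      Uq.counitHom, ← TensorProduct.smul_tmul', TensorProduct.tmul_smul, smul_smul, h0]

theorem invSpinor_homogeneous (k l : ℕ) (i : ℤ) (a : Fin 2) :
    invSpinor q a ∈ homogeneous (thetaHat q k l i) (i + k + (a : ℤ) * (l - k)) := by
  refine Submodule.sub_mem _ ?_ (Submodule.smul_mem _ _ ?_)
  · convert t_tmul_single_mem q k l i 1 a 1 0 using 2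
    simp [degree, spinDegree]
    ring
  · convert t_tmul_single_mem q k l i 1 a 0 1 using 2
    simp [degree, spinDegree]
    ring

theorem spinorEval_invSpinor (a : Fin 2) : spinorEval q 1 (invSpinor q a) =
    if a = 1 then Pi.single 0 1 else -((rt q)⁻¹ * (rt q)⁻¹) • (Pi.single 1 1 : Spin) := by
  rw [invSpinor, map_sub, map_smul, spinorEval_tmul, spinorEval_tmul, toDual_t_one, toDual_t_one]
  fin_cases a <;> simp

/-! ### Inequivalence -/

theorem eq_of_intertwines_thetaSpin {k l : ℕ} {i j : ℤ} {S : Spin ≃ₗ[ℂ] Spin}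
    (hS : Intertwines (thetaSpin k l i) (thetaSpin k l j) S) : i = j := by
  have h := hS.sum_degree_eq (I := ⊤) (fun _ _ => trivial) (w := fun b => Pi.single b 1)
    (fun _ => trivial) (π := LinearMap.id) (fun _ => rfl) (fun _ _ h => h)
    (single_mem_homogeneous k l i) (single_mem_homogeneous k l j)
  simp only [spinDegree] at h
  linarith

theorem eq_of_equivalent_thetaHat {k l : ℕ} {i j : ℤ}
    (h : Equivalent q (thetaHat q k l i) (thetaHat q k l j)) : i = j := by
  obtain ⟨S, hS, hint⟩ := h
  have h0 := rt_ne_zero q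
  -- The invariant spinors normalized so that their values at `1` are `e₋` and `e₊`.
  have hw (n : ℤ) (b : Fin 2) : (![invSpinor q 1, -(rt q * rt q) • invSpinor q 0] : Fin 2 → _) b ∈
      homogeneous (thetaHat q k l n) ((![n + l, n + k] : Fin 2 → ℤ) b) := by
    fin_cases b
    · simpa using invSpinor_homogeneous q k l n 1
    · exact Submodule.smul_mem _ _ (by simpa using invSpinor_homogeneous q k l n 0)
  have h := hint.sum_degree_eq (I := invariants q)
    (fun v hv => (mem_invariants q).2 fun x => by
      rw [← hS, (mem_invariants q).1 hv, map_smul])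
    (w := ![invSpinor q 1, -(rt q * rt q) • invSpinor q 0])
    (fun b => by
      fin_cases b
      · exact invSpinor_mem q 1
      · exact Submodule.smul_mem _ _ (invSpinor_mem q 0))
    (π := spinorEval q 1)
    (fun b => by
      fin_cases b
      · simp [spinorEval_invSpinor]
      · simp [spinorEval_invSpinor, smul_smul]
        field_simp
        simp)
    (fun v hv => spinorEval_one_injective q hv) (hw i) (hw j)
  simp only [Matrix.cons_val_zero, Matrix.cons_val_one] at h
  linarith

/-! ### Classification of the equivariant lifts -/

theorem del'_gen_one_tmul (g : Gen) (v : Spin) :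
    del' q (Uq.gen q g) (1 ⊗ₜ v) = 1 ⊗ₜ rho q (Uq.gen q g) v := by
  have h0 := rt_ne_zero q
  rw [← t_zero]
  cases g
  · simp [del'_e_tmul, del_t, eMat, kinvMat_eq]
  · simp [del'_f_tmul, del_t, fMat, kinvMat_eq]
  · simp [del'_k_tmul, del_t, kMat_eq]
  · simp [del'_kinv_tmul, del_t, kinvMat_eq]

theorem delB_gen_rTensor (g : Gen) (b : B) (z : Spin ⊗[ℂ] B) :
    delB q (Uq.gen q g ⊗ₜ b) (LinearMap.rTensor B (TensorProduct.mk ℂ (CoordAlg q) Spin 1) z) =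
      LinearMap.rTensor B (TensorProduct.mk ℂ (CoordAlg q) Spin 1)
        (TensorProduct.map (rho q (Uq.gen q g)) (LinearMap.mulLeft ℂ b) z) := by
  induction z using TensorProduct.induction_on with
  | zero => simp
  | add y z hy hz => simp only [map_add, hy, hz]
  | tmul v c => simp [delB_tmul, del'_gen_one_tmul]

theorem rTensor_mk_one_injective : Function.Injective
    (LinearMap.rTensor B (TensorProduct.mk ℂ (CoordAlg q) Spin 1)) := by
  refine Function.LeftInverse.injective (g := LinearMap.rTensor B (spinorEval q 1)) fun z => ?_
  rw [← LinearMap.comp_apply, ← LinearMap.rTensor_comp]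
  have : spinorEval q 1 ∘ₗ TensorProduct.mk ℂ (CoordAlg q) Spin 1 = LinearMap.id := by
    refine LinearMap.ext fun v => ?_
    rw [LinearMap.comp_apply, TensorProduct.mk_apply, spinorEval_tmul, toDual_one_one, one_smul]
    rfl
  rw [this, LinearMap.rTensor_id, LinearMap.id_apply]

theorem tensorCoaction_one_tmul (k l : ℕ) (θ' : Spin →ₗ[ℂ] Spin ⊗[ℂ] B) (v : Spin) :
    tensorCoaction (theta q k l).toLinearMap θ' (1 ⊗ₜ v) =
      LinearMap.rTensor B (TensorProduct.mk ℂ (CoordAlg q) Spin 1) (θ' v) := by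
  refine tensorCoaction_tmul_of_invariant θ' ?_ v
  rw [AlgHom.toLinearMap_apply, map_one, Algebra.TensorProduct.one_def]

/-- The second factor of an equivariant lift is equivariant on `M_{1/2}`, as `U_q(su₂)` acts on
`1 ⊗ M_{1/2}` through `ϱ_{1/2}`. -/
theorem equivariant_factor {k l : ℕ} {θ' : Spin →ₗ[ℂ] Spin ⊗[ℂ] B}
    (h : IsEquivariant q k l (tensorCoaction (theta q k l).toLinearMap θ')) (g : Gen) (v : Spin) :
    θ' (rho q (Uq.gen q g) v) = TensorProduct.map (rho q (Uq.gen q g))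
      (LinearMap.mulLeft ℂ (u (-(g.wt * (k + l))))) (θ' v) := by
  apply rTensor_mk_one_injective q
  rw [← tensorCoaction_one_tmul q k l, ← delB_gen_rTensor, ← del'_gen_one_tmul, h, thetaU_gen,
    tensorCoaction_one_tmul]

theorem rho_k_single (b : Fin 2) : rho q (Uq.k q) (Pi.single b 1) =
    (if b = 0 then (rt q)⁻¹ else rt q) • (Pi.single b 1 : Spin) := by
  rw [rho_single]
  fin_cases b <;> simp [kMat_one]

theorem rho_f_single_one : rho q (Uq.f q) (Pi.single 1 1) = (Pi.single 0 1 : Spin) := by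
  rw [rho_single]
  simp [fMat_one]

/-- The second factor of an equivariant lift preserves weights, so it maps `e₊` to `e₊ ⊗ B`. -/
theorem exists_tmul_of_equivariant {k l : ℕ} {θ' : Spin →ₗ[ℂ] Spin ⊗[ℂ] B}
    (h : IsEquivariant q k l (tensorCoaction (theta q k l).toLinearMap θ')) :
    ∃ z : B, θ' (Pi.single 1 1) = Pi.single 1 1 ⊗ₜ z := by
  have h0 := rt_ne_zero q
  have h4 := rt_four_ne q
  have hexp (y : Spin ⊗[ℂ] B) : y = ∑ b, Pi.single b 1 ⊗ₜ slice (LinearMap.proj b) y := by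
    induction y using TensorProduct.induction_on with
    | zero => simp
    | add y z hy hz =>
      simp only [map_add, TensorProduct.tmul_add, Finset.sum_add_distrib]
      rw [← hy, ← hz]
    | tmul v c =>
      simp only [slice_tmul, LinearMap.proj_apply, ← TensorProduct.smul_tmul,
        ← TensorProduct.sum_tmul]
      congr 1
      ext a
      simp [Pi.single_apply, -Fin.sum_univ_two]
  have hproj : (LinearMap.proj 0 : Spin →ₗ[ℂ] ℂ) ∘ₗ rho q (Uq.k q) =
      (rt q)⁻¹ • LinearMap.proj 0 := by
    refine LinearMap.pi_ext' fun b => LinearMap.ext_ring ?_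
    simp only [LinearMap.comp_apply, LinearMap.single_apply, rho_k_single]
    fin_cases b <;> simp
  -- `k` has distinct eigenvalues on `e₊` and `e₋`, so `θ'(e₊)` has no component along `e₋`.
  have hslice : slice (LinearMap.proj 0) (θ' (Pi.single 1 1)) = 0 := by
    have h1 : θ' (rho q (Uq.k q) _) = _ := equivariant_factor q h .k (Pi.single 1 1)
    have h2 := congrArg (slice (LinearMap.proj 0)) h1
    rw [slice_map, hproj, rho_k_single, map_smul, map_smul] at h2
    have h3 : slice ((rt q)⁻¹ • LinearMap.proj 0) (θ' (Pi.single 1 1)) =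
        (rt q)⁻¹ • slice (LinearMap.proj 0) (θ' (Pi.single 1 1)) := by
      simp [slice, LinearMap.rTensor_smul]
    rw [h3] at h2
    simp only [Gen.wt, one_ne_zero, if_false, zero_mul, neg_zero, u, LaurentPolynomial.T_zero,
      LinearMap.mulLeft_one, LinearMap.id_apply] at h2
    rw [← sub_eq_zero, ← sub_smul, smul_eq_zero] at h2
    refine h2.resolve_left fun h5 => h4 ?_
    field_simp at h5
    linear_combination (rt q ^ 2 + 1) * h5
  refine ⟨slice (LinearMap.proj 1) (θ' (Pi.single 1 1)), (hexp _).trans ?_⟩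
  rw [Fin.sum_univ_two, hslice, TensorProduct.tmul_zero, zero_add]

/-- The coefficient of a coaction along a vector spanning a one-dimensional subcomodule is
grouplike, hence a power of `u`. -/
theorem IsCoaction.exists_eq_u {δ : Spin →ₗ[ℂ] Spin ⊗[ℂ] B} (hδ : IsCoaction δ) {z : B}
    {b : Fin 2} (h : δ (Pi.single b 1) = Pi.single b 1 ⊗ₜ z) : ∃ i : ℤ, z = u i := by
  have hz : IsGroupLikeElem ℂ z := by
    constructor
    · have h1 := LinearMap.congr_fun hδ.counit (Pi.single b 1)
      simp only [LinearMap.comp_apply, h] at h1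
      simpa using congrFun h1 b
    · have h1 := LinearMap.congr_fun hδ.coassoc (Pi.single b 1)
      simp only [LinearMap.comp_apply, h] at h1
      simp [h] at h1
      have h2 := congrArg (TensorProduct.lid ℂ (B ⊗[ℂ] B) ∘
        LinearMap.rTensor (B ⊗[ℂ] B) (LinearMap.proj b)) h1
      simpa using h2.symm
  obtain ⟨i, hi⟩ := AddMonoidAlgebra.isGroupLikeElem_iff_mem_range_of.1 hz
  exact ⟨i.toAdd, hi.symm⟩

theorem exists_eq_thetaHat {k l : ℕ} {δ : Spinors q →ₗ[ℂ] Spinors q ⊗[ℂ] B}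
    (hδ : IsLift q k l δ) (h : IsEquivariant q k l δ) : ∃ i : ℤ, δ = thetaHat q k l i := by
  obtain ⟨-, θ', hθ', rfl⟩ := hδ
  obtain ⟨z, hz⟩ := exists_tmul_of_equivariant q h
  obtain ⟨i, rfl⟩ := hθ'.exists_eq_u hz
  refine ⟨i, ?_⟩
  have h1 : θ' (Pi.single 0 1) = Pi.single 0 1 ⊗ₜ u (i + k + l) := by
    have h2 : θ' (rho q (Uq.f q) _) = _ := equivariant_factor q h .f (Pi.single 1 1)
    rw [rho_f_single_one] at h2
    rw [h2, hz, TensorProduct.map_tmul, rho_f_single_one, LinearMap.mulLeft_apply, u, u,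
      ← LaurentPolynomial.T_add]
    congr 2
    simp only [Gen.wt]
    ring
  have h3 : θ' = thetaSpin k l i := by
    refine (Pi.basisFun ℂ (Fin 2)).ext fun b => ?_
    rw [thetaSpin, Module.Basis.constr_basis, Pi.basisFun_apply]
    fin_cases b
    · exact h1
    · exact hz
  rw [h3, thetaHat]

theorem thetaHat_injective (k l : ℕ) : Function.Injective (thetaHat q k l) := by
  intro i j h
  refine eq_of_equivalent_thetaHat q (k := k) (l := l) ⟨LinearEquiv.refl ℂ _, fun _ _ => rfl, ?_⟩
  intro v
  rw [h]
  simp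

end QuantumSU2

end

theorem proposition5 (q : Set.Ioo (0 : ℝ) 1) (k l : ℕ) (hk : 0 < k) (hl : 0 < l)
    (hkl : Nat.Coprime k l) :
    (∀ i : ℤ, QuantumSU2.IsCoaction (QuantumSU2.thetaSpin k l i) ∧
      QuantumSU2.IsLift q k l (QuantumSU2.thetaHat q k l i) ∧
      QuantumSU2.IsEquivariant q k l (QuantumSU2.thetaHat q k l i)) ∧
    (∀ δ : QuantumSU2.Spinors q →ₗ[ℂ] TensorProduct ℂ (QuantumSU2.Spinors q) QuantumSU2.B,
      QuantumSU2.IsLift q k l δ → QuantumSU2.IsEquivariant q k l δ →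
        ∃! i : ℤ, δ = QuantumSU2.thetaHat q k l i) ∧
    (∀ i j : ℤ, i ≠ j →
      ¬ QuantumSU2.Equivalent q (QuantumSU2.thetaHat q k l i) (QuantumSU2.thetaHat q k l j)) ∧
    (∀ i j : ℤ, i ≠ j → ¬ ∃ S : QuantumSU2.Spin ≃ₗ[ℂ] QuantumSU2.Spin,
      QuantumSU2.Intertwines (QuantumSU2.thetaSpin k l i) (QuantumSU2.thetaSpin k l j) S) := by
  refine ⟨fun i => ⟨QuantumSU2.isCoaction_thetaSpin k l i, QuantumSU2.isLift_thetaHat q k l i,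
    QuantumSU2.isEquivariant_thetaHat q k l i⟩, fun δ hδ h => ?_,
    fun i j hij h => hij (QuantumSU2.eq_of_equivalent_thetaHat q h),
    fun i j hij ⟨S, hS⟩ => hij (QuantumSU2.eq_of_intertwines_thetaSpin hS)⟩
  obtain ⟨i, rfl⟩ := QuantumSU2.exists_eq_thetaHat q hδ h
  exact ⟨i, rfl, fun j hj => (QuantumSU2.thetaHat_injective q k l hj).symm⟩
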